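/- Let $X,U,Y$ be complex Banach spaces. A closed linear operator $A:D(A)\to X$, $D(A)\subseteq X$, is called sectorial if for some $\omega\in[0,\pi)$ its spectrum is contained in $\overline{S(\omega)}$, where $S(\omega)=\{z\neq 0: |\arg z|<\omega\}$ for $\omega>0$ and $S(0)=(0,\infty)$, and $\sup\{\|\lambda(\lambda-A)^{-1}\| : |\arg\lambda|\ge\nu\}<\infty$ for every $\nu\in(\omega,\pi)$. Let $A$ be an injective sectorial operator on $X$, let $k\ge 1$ be an integer and let $\theta\in(0,1)$. Let $X_k$ be $D(A^k)$ with the norm $\|(I+A)^kx\|$, let $X_{-k}$ be the completion of $X$ in the norm $\|(I+A)^{-k}x\|$, and let $A_{-k}$ be the extension of $A$ to $X_{-k}$, i.e. the operator in $X_{-k}$ whose graph is the closure of the graph of $A$. Let $\dot X_k$ be the completion of $D(A^k)$ in the norm $\|A^kx\|$ and $\dot X_{-k}$ the completion of $D(A^{-k})=\operatorname{ran}(A^k)$ in the norm $\|A^{-k}x\|$. All these spaces are regarded as subspaces of the completion of $X$ in the norm $\|A^k(I+A)^{-2k}x\|$, and $(\cdot,\cdot)_{\theta,q}$ denotes the real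 interpolation space given by the K-method: with $K(t,v)=\inf\{\|a\|_{E_0}+t\|b\|_{E_1}: v=a+b,\ a\in E_0,\ b\in E_1\}$, the norms of $(E_0,E_1)_{\theta,\infty}$ and $(E_0,E_1)_{\theta,1}$ are $\sup_{t>0}t^{-\theta}K(t,v)$ and $\int_0^\infty t^{-\theta}K(t,v)\,\frac{dt}{t}$. Let $C:X_k\to Y$ and $B:U\to X_{-k}$ be bounded linear operators. Then: (a) $\sup_{0<\lambda<\infty}\|\lambda^{k\theta}(\lambda+A_{-k})^{-k}B\|_{U\to X}<\infty$ if and only if $B$ is bounded in the norm $U\to(\dot X_{-k},X)_{\theta,\infty}$, i.e. there is $M$ with $\|Bu\|_{(\dot X_{-k},X)_{\theta,\infty}}\le M\|u\|_U$ for all $u\in U$ (in particular $Bu$ belongs to this space). (b) $\sup_{0<\lambda<\infty}\|\lambda^{k(1-\theta)}C(\lambda+A)^{-k}\|_{X\to Y}<\infty$ if and only if $C$ is bounded in the norm $(X,\dot X_k)_{\theta,1}\to Y$, i.e. there is $M$ with $\|Cx\|_Y\le M\|x\|_{(X,\dot X_k)_{\theta,1}}$ for all $x\in X_k$. -/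

import Mathlib

open MeasureTheory
open scoped ENNReal NNReal

noncomputable section

namespace SectorialInterpolation

/-! ### Unbounded operators: resolvents, sectoriality, powers -/

section Operators

variable {E : Type*} [NormedAddCommGroup E] [NormedSpace ℂ E]

/-- The bounded operator `R` is a two-sided inverse of `z - A : D(A) → E`. -/
def IsResolventAt (A : E →ₗ.[ℂ] E) (z : ℂ) (R : E →L[ℂ] E) : Prop :=
  (∀ x : E, ∃ h : R x ∈ A.domain, z • R x - A ⟨R x, h⟩ = x) ∧
    ∀ x : A.domain, R (z • (x : E) - A x) = x

/-- The resolvent set `ρ(A)`. -/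
def resolventSetOf (A : E →ₗ.[ℂ] E) : Set ℂ :=
  {z | ∃ R : E →L[ℂ] E, IsResolventAt A z R}

open Classical in
/-- The resolvent `R(z, A) = (z - A)⁻¹` for `z ∈ ρ(A)`, and `0` for `z ∉ ρ(A)`. -/
def resolventAt (A : E →ₗ.[ℂ] E) (z : ℂ) : E →L[ℂ] E :=
  if h : ∃ R : E →L[ℂ] E, IsResolventAt A z R then h.choose else 0

/-- The bounded operator `(l + A)⁻¹ = -R(-l, A)`, for `-l ∈ ρ(A)`. -/
def plusInv (A : E →ₗ.[ℂ] E) (l : ℝ) : E →L[ℂ] E :=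
  -resolventAt A (-(l : ℂ))

/-- The open sector `S(ω)` for `ω > 0`; `S(0)` is the open positive half-line. -/
def sector (ω : ℝ) : Set ℂ :=
  {z | z ≠ 0 ∧ (|z.arg| < ω ∨ (ω = 0 ∧ z.arg = 0))}

/-- `A` is a sectorial operator of type `ω ∈ [0, π)` (no density of domain or range is assumed). -/
structure IsSectorialOfType (A : E →ₗ.[ℂ] E) (ω : ℝ) : Prop where
  nonneg : 0 ≤ ω
  lt_pi : ω < Real.pi
  isClosed : A.IsClosed
  spectrum_subset : (resolventSetOf A)ᶜ ⊆ closure (sector ω)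
  bound : ∀ ν : ℝ, ω < ν → ν < Real.pi →
    ∃ M : ℝ, ∀ z : ℂ, ν ≤ |z.arg| → ‖z • resolventAt A z‖ ≤ M

/-- `A` is a sectorial operator (of some type). -/
def IsSectorial (A : E →ₗ.[ℂ] E) : Prop :=
  ∃ ω : ℝ, IsSectorialOfType A ω

/-- The composition `g ∘ f` with its natural domain `{x ∈ D(f) | f x ∈ D(g)}`. -/
def opComp (g f : E →ₗ.[ℂ] E) : E →ₗ.[ℂ] E :=
  g.comp (f.domRestrict ((g.domain.comap f.toFun).map f.domain.subtype)) (by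
    rintro ⟨x, hx, hx'⟩
    obtain ⟨y, hy, rfl⟩ := hx
    exact hy)

/-- The power `A ^ n` with its natural domain. -/
def opPow (A : E →ₗ.[ℂ] E) : ℕ → (E →ₗ.[ℂ] E)
  | 0 => ⟨⊤, Submodule.subtype ⊤⟩
  | n + 1 => opComp (opPow A n) A

/-- The operator `Id + A` with domain `D(A)`. -/
def idPlus (A : E →ₗ.[ℂ] E) : E →ₗ.[ℂ] E :=
  (LinearMap.id : E →ₗ[ℂ] E) +ᵥ A

theorem mem_opComp {g f : E →ₗ.[ℂ] E} {x : E} :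
    x ∈ (opComp g f).domain ↔ ∃ h : x ∈ f.domain, f ⟨x, h⟩ ∈ g.domain := by
  constructor
  · rintro ⟨hx, hx'⟩
    obtain ⟨y, hy, rfl⟩ := hx
    exact ⟨y.2, hy⟩
  · rintro ⟨h, h'⟩
    exact ⟨⟨⟨x, h⟩, h', rfl⟩, h⟩

theorem opComp_apply {g f : E →ₗ.[ℂ] E} {x : E} (hx : x ∈ (opComp g f).domain)
    (h : x ∈ f.domain) (h' : f ⟨x, h⟩ ∈ g.domain) :
    opComp g f ⟨x, hx⟩ = g ⟨f ⟨x, h⟩, h'⟩ := rfl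

theorem mem_opPow_succ {A : E →ₗ.[ℂ] E} {n : ℕ} {x : E} :
    x ∈ (opPow A (n + 1)).domain ↔ ∃ h : x ∈ A.domain, A ⟨x, h⟩ ∈ (opPow A n).domain :=
  mem_opComp

theorem opPow_succ_le (A : E →ₗ.[ℂ] E) (n : ℕ) :
    (opPow A (n + 1)).domain ≤ (opPow A n).domain := by
  induction n with
  | zero => exact fun x _ => Submodule.mem_top
  | succ n ih =>
    intro x hx
    obtain ⟨h, h'⟩ := mem_opPow_succ.1 hx
    exact mem_opPow_succ.2 ⟨h, ih h'⟩

theorem opPow_domain_le_idPlus (A : E →ₗ.[ℂ] E) (n : ℕ) :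
    (opPow A n).domain ≤ (opPow (idPlus A) n).domain := by
  induction n with
  | zero => exact fun x _ => Submodule.mem_top
  | succ n ih =>
    intro x hx
    obtain ⟨h, h'⟩ := mem_opPow_succ.1 hx
    refine mem_opPow_succ.2 ⟨h, ?_⟩
    have h2 : x + A ⟨x, h⟩ ∈ (opPow A n).domain :=
      Submodule.add_mem _ (opPow_succ_le A n hx) h'
    exact ih h2

theorem plusInv_mem (A : E →ₗ.[ℂ] E) (l : ℝ) (n : ℕ) {x : E} (hx : x ∈ (opPow A n).domain) :
    plusInv A l x ∈ (opPow A (n + 1)).domain := by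
  classical
  by_cases H : ∃ R : E →L[ℂ] E, IsResolventAt A (-(l : ℂ)) R
  · have key : ∀ y : E, ∃ h : plusInv A l y ∈ A.domain,
        A ⟨plusInv A l y, h⟩ = y - (l : ℂ) • plusInv A l y := by
      intro y
      have e : plusInv A l y = -(H.choose y) := by
        simp [plusInv, resolventAt, H]
      obtain ⟨h, h'⟩ := H.choose_spec.1 y
      refine ⟨by rw [e]; exact Submodule.neg_mem _ h, ?_⟩
      have e2 : (⟨plusInv A l y, by rw [e]; exact Submodule.neg_mem _ h⟩ : A.domain)
          = -⟨H.choose y, h⟩ := Subtype.ext e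
      rw [e2, LinearPMap.map_neg, e]
      nth_rewrite 2 [← h']
      simp only [neg_smul, smul_neg]
      abel
    induction n with
    | zero =>
      obtain ⟨h, _⟩ := key x
      exact mem_opPow_succ.2 ⟨h, Submodule.mem_top⟩
    | succ n ih =>
      obtain ⟨h, h'⟩ := key x
      refine mem_opPow_succ.2 ⟨h, ?_⟩
      rw [h']
      exact Submodule.sub_mem _ hx
        (Submodule.smul_mem _ _ (ih (opPow_succ_le A n hx)))
  · have e : plusInv A l x = 0 := by simp [plusInv, resolventAt, H]
    rw [e]
    exact Submodule.zero_mem _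

theorem plusInv_pow_mem (A : E →ₗ.[ℂ] E) (l : ℝ) (n : ℕ) (x : E) :
    (plusInv A l ^ n) x ∈ (opPow A n).domain := by
  induction n with
  | zero => exact Submodule.mem_top
  | succ n ih =>
    rw [pow_succ']
    exact plusInv_mem A l n ih

/-- `(l + A)⁻ᵏ` as a linear map `E → D(Aᵏ)`. -/
def plusInvPow (A : E →ₗ.[ℂ] E) (l : ℝ) (k : ℕ) : E →ₗ[ℂ] (opPow A k).domain :=
  ((plusInv A l ^ k : E →L[ℂ] E) : E →ₗ[ℂ] E).codRestrict _ (plusInv_pow_mem A l k)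

end Operators

/-! ### Renormed spaces and their completions -/

section Renorm

variable {D E : Type*} [AddCommGroup D] [Module ℂ D] [NormedAddCommGroup E] [NormedSpace ℂ E]

/-- The vector space `D`, equipped with the norm `d ↦ ‖T d‖`, which is a norm if `T` is
injective. -/
def Renorm (_T : D →ₗ[ℂ] E) : Type _ := D

instance (T : D →ₗ[ℂ] E) : AddCommGroup (Renorm T) := inferInstanceAs (AddCommGroup D)

instance (T : D →ₗ[ℂ] E) : Module ℂ (Renorm T) := inferInstanceAs (Module ℂ D)

/-- The identity map from `D` to the renormed space. -/
def toRenorm (T : D →ₗ[ℂ] E) : D ≃ₗ[ℂ] Renorm T := LinearEquiv.refl ℂ D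

instance (T : D →ₗ[ℂ] E) : SeminormedAddCommGroup (Renorm T) :=
  SeminormedAddCommGroup.induced (Renorm T) E (T ∘ₗ (toRenorm T).symm.toLinearMap)

instance (T : D →ₗ[ℂ] E) : NormedSpace ℂ (Renorm T) :=
  NormedSpace.induced ℂ (Renorm T) E (T ∘ₗ (toRenorm T).symm.toLinearMap)

theorem norm_toRenorm (T : D →ₗ[ℂ] E) (d : D) : ‖toRenorm T d‖ = ‖T d‖ := rfl

/-- The completion of `D` with respect to the norm `‖T ·‖`. -/
abbrev Compl (T : D →ₗ[ℂ] E) : Type _ := UniformSpace.Completion (Renorm T)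

/-- The canonical map of `D` into its completion with respect to `‖T ·‖`. -/
def toCompl (T : D →ₗ[ℂ] E) : D →ₗ[ℂ] Compl T :=
  (UniformSpace.Completion.toComplₗᵢ (𝕜 := ℂ) (E := Renorm T)).toLinearMap ∘ₗ
    (toRenorm T).toLinearMap

/-- The continuous extension to the completions of a map `j : D → D'` that is continuous
for the norms `‖T ·‖` and `‖T' ·‖`. -/
def complMap {D' : Type*} [AddCommGroup D'] [Module ℂ D'] (T : D →ₗ[ℂ] E) (T' : D' →ₗ[ℂ] E)
    (j : D →ₗ[ℂ] D') : Compl T → Compl T' :=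
  UniformSpace.Completion.map fun w : Renorm T => toRenorm T' (j ((toRenorm T).symm w))

end Renorm

/-! ### Inhomogeneous and homogeneous extrapolation spaces -/

section Scales

variable {X : Type*} [NormedAddCommGroup X] [NormedSpace ℂ X]

/-- `(Id + A)ᵏ` on `D(Aᵏ)`. -/
def idPlusPow (A : X →ₗ.[ℂ] X) (k : ℕ) : (opPow A k).domain →ₗ[ℂ] X :=
  (opPow (idPlus A) k).toFun ∘ₗ Submodule.inclusion (opPow_domain_le_idPlus A k)

/-- `X_k`: the space `D(Aᵏ)` with the norm `‖(Id + A)ᵏ ·‖`. -/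
abbrev XPos (A : X →ₗ.[ℂ] X) (k : ℕ) : Type _ := Renorm (idPlusPow A k)

/-- `(Id + A)⁻ᵏ` as a linear map on `X`. -/
def idPlusInvPow (A : X →ₗ.[ℂ] X) (k : ℕ) : X →ₗ[ℂ] X :=
  ((plusInv A 1 ^ k : X →L[ℂ] X) : X →ₗ[ℂ] X)

/-- `X_{-k}`: the completion of `X` with respect to the norm `‖(Id + A)⁻ᵏ ·‖`. -/
abbrev XNeg (A : X →ₗ.[ℂ] X) (k : ℕ) : Type _ := Compl (idPlusInvPow A k)

/-- The canonical embedding `X → X_{-k}`. -/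
def toXNeg (A : X →ₗ.[ℂ] X) (k : ℕ) : X →ₗ[ℂ] XNeg A k := toCompl (idPlusInvPow A k)

/-- The extension `A_{-k}` of `A` to `X_{-k}`: the operator in `X_{-k}` whose graph is the closure
in `X_{-k} × X_{-k}` of the graph of `A`. -/
def extrapolated (A : X →ₗ.[ℂ] X) (k : ℕ) : XNeg A k →ₗ.[ℂ] XNeg A k :=
  ((A.graph.map ((toXNeg A k).prodMap (toXNeg A k))).topologicalClosure).toLinearPMap

/-- `A⁻ᵏ`, the `k`-th power of the (unbounded) inverse of `A`, with domain `ran(Aᵏ)`. -/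
def invPow (A : X →ₗ.[ℂ] X) (k : ℕ) : X →ₗ.[ℂ] X := opPow A.inverse k

/-- The homogeneous space `Ẋ_k`: the completion of `D(Aᵏ)` in the norm `‖Aᵏ ·‖`. -/
abbrev XDotPos (A : X →ₗ.[ℂ] X) (k : ℕ) : Type _ := Compl (opPow A k).toFun

/-- The homogeneous space `Ẋ_{-k}`: the completion of `D(A⁻ᵏ)` in the norm `‖A⁻ᵏ ·‖`. -/
abbrev XDotNeg (A : X →ₗ.[ℂ] X) (k : ℕ) : Type _ := Compl (invPow A k).toFun

/-- The bounded operator `Aᵏ (Id + A)⁻²ᵏ` on `X`. -/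
def regularizer (A : X →ₗ.[ℂ] X) (k : ℕ) : X →ₗ[ℂ] X :=
  (opPow A k).toFun ∘ₗ plusInvPow A 1 k ∘ₗ idPlusInvPow A k

/-- The ambient space, the completion of `X` in the norm `‖Aᵏ (Id + A)⁻²ᵏ ·‖`. It contains
`X`, `X_{-k}`, `Ẋ_k` and `Ẋ_{-k}`, each through the continuous extension of the
identity. -/
abbrev Ambient (A : X →ₗ.[ℂ] X) (k : ℕ) : Type _ := Compl (regularizer A k)

/-- The embedding of `X` into the ambient space. -/
def embX (A : X →ₗ.[ℂ] X) (k : ℕ) : X → Ambient A k := toCompl (regularizer A k)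

/-- The embedding of `X_k = D(Aᵏ)` into the ambient space. -/
def embXPos (A : X →ₗ.[ℂ] X) (k : ℕ) (x : XPos A k) : Ambient A k :=
  embX A k ((toRenorm (idPlusPow A k)).symm x : X)

/-- The embedding of `X_{-k}` into the ambient space. -/
def embXNeg (A : X →ₗ.[ℂ] X) (k : ℕ) : XNeg A k → Ambient A k :=
  complMap (idPlusInvPow A k) (regularizer A k) LinearMap.id

/-- The embedding of `Ẋ_k` into the ambient space. -/
def embXDotPos (A : X →ₗ.[ℂ] X) (k : ℕ) : XDotPos A k → Ambient A k :=
  complMap (opPow A k).toFun (regularizer A k) (opPow A k).domain.subtype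

/-- The embedding of `Ẋ_{-k}` into the ambient space. -/
def embXDotNeg (A : X →ₗ.[ℂ] X) (k : ℕ) : XDotNeg A k → Ambient A k :=
  complMap (invPow A k).toFun (regularizer A k) (invPow A k).domain.subtype

end Scales

/-! ### Real interpolation by the K-method -/

section Interpolation

variable {E₀ E₁ V : Type*} [NormedAddCommGroup E₀] [NormedAddCommGroup E₁] [AddCommGroup V]

/-- The K-functional `K(t, v) = inf {‖a‖ + t ‖b‖ | v = a + b, a ∈ E₀, b ∈ E₁}` of a couple
embedded into `V` through `i₀` and `i₁`; it is `∞` if `v ∉ E₀ + E₁`. -/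
def kFunctional (i₀ : E₀ → V) (i₁ : E₁ → V) (t : ℝ) (v : V) : ℝ≥0∞ :=
  ⨅ (a : E₀) (b : E₁) (_ : i₀ a + i₁ b = v), ‖a‖ₑ + ENNReal.ofReal t * ‖b‖ₑ

/-- The norm of the real interpolation space `(E₀, E₁)_{θ,q}`; the space consists of the `v`
for which it is finite. -/
def interpNorm (i₀ : E₀ → V) (i₁ : E₁ → V) (θ : ℝ) (q : ℝ≥0∞) (v : V) : ℝ≥0∞ :=
  if q = ∞ then
    ⨆ (t : ℝ) (_ : 0 < t), ENNReal.ofReal (t ^ (-θ)) * kFunctional i₀ i₁ t v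
  else
    (∫⁻ t in Set.Ioi (0 : ℝ),
      (ENNReal.ofReal (t ^ (-θ)) * kFunctional i₀ i₁ t v) ^ q.toReal * ENNReal.ofReal t⁻¹)
        ^ (1 / q.toReal)

end Interpolation

end SectorialInterpolation

end

open SectorialInterpolation

noncomputable section

namespace SectorialInterpolation

/-! ### Sectors and the negative half-line -/

/-! Write `R_l = (l + A)⁻¹`, `D_l = A (l + A)⁻¹`, `T_l = (1 + A)(l + A)⁻¹` and `s = l R_l`, so that
`D_l = 1 - s` and, by sectoriality, `‖s‖` is bounded uniformly in `l > 0`. Nothing else about the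
spectrum is used.

Each completion is realized isometrically as a closed subspace of `X` (`complIsometry`). The
embeddings of `X`, `X_{-k}`, `Ẋ_k`, `Ẋ_{-k}` into the ambient space then become the bounded
operators `D_1^k R_1^k`, `D_1^k`, `R_1^{2k}`, `D_1^{2k}`, all injective. Every identity in the
ambient space is thus an identity between commuting bounded operators on `X`; density of the domain
or range is never needed.

For `B`, with `t = l^{-k}`, the norm of `x = (l + A_{-k})^{-k} w` is equivalent to `K(t, w)`. If `w
= a + b`, then `x = D_l^k (A^{-k} a) + R_l^k b`, which gives `‖x‖ ≤ c K(t, w)`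
(`enorm_le_kFunctional_neg`). Conversely, a polynomial identity `1 = (1 - s)^k p(s) + s^k q(s)`
splits `w` into `A^k p(s) x` and `l^k q(s) x` (`kFunctional_neg_le`). Taking the supremum over `t`
gives the equivalence.

For `C`, the elements `(l + A)^{-k} x` satisfy `K(t, ·) ≤ c ‖x‖ min(l^{-k}, t)`, and integration
gives one direction (`interpNorm_plusInvPow_le`). For the other, choose `Q = X^k q` with `1 - Q = (1
- X)^k p` and `Q'` a multiple of `X^{k-1} (1 - X)^{k-1}`. Since `l ds/dl = s (1 - s)`, the function
`t ↦ C Q(s) x` has derivative a multiple of `t⁻¹ C s^k D_l^k x`. It runs from `C x` at `t = 0` to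
`0` at `t = ∞`. The hypothesis bounds `C s^k` by a multiple of `t^{-θ}`, and `‖D_l^k x‖ ≤ c K(t,
x)`, so `‖C x‖` is controlled by the integral defining the interpolation norm
(`enorm_le_interpNorm`). -/

theorem neg_notMem_closure_sector {ω l : ℝ} (h₀ : 0 ≤ ω) (hπ : ω < Real.pi) (hl : 0 < l) :
    -(l : ℂ) ∉ closure (sector ω) := by
  -- The argument is discontinuous on the negative half-line, so the sector is enclosed in a set
  -- defined by a closed condition; a negative real in it would force `cos ω ≤ -1`.
  have hsub : sector ω ⊆ {z : ℂ | ‖z‖ * Real.cos ω ≤ z.re} := by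
    rintro z ⟨hz, h⟩
    have harg : |z.arg| ≤ ω := by
      rcases h with h | ⟨h, h'⟩
      · exact h.le
      · simp [h, h']
    have hcos : Real.cos ω ≤ Real.cos z.arg := by
      rw [← Real.cos_abs z.arg]
      exact Real.cos_le_cos_of_nonneg_of_le_pi (abs_nonneg _) hπ.le harg
    calc ‖z‖ * Real.cos ω ≤ ‖z‖ * Real.cos z.arg := by gcongr
      _ = z.re := Complex.norm_mul_cos_arg z
  have hclosed : IsClosed {z : ℂ | ‖z‖ * Real.cos ω ≤ z.re} :=
    isClosed_le (by fun_prop) (by fun_prop)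
  intro hmem
  have h1 := closure_minimal hsub hclosed hmem
  have h2 : -1 < Real.cos ω := by
    rw [← Real.cos_pi]
    exact Real.cos_lt_cos_of_nonneg_of_le_pi h₀ le_rfl hπ
  simp only [Set.mem_ofPred_eq, norm_neg, Complex.norm_real, Real.norm_eq_abs, abs_of_pos hl,
    Complex.neg_re, Complex.ofReal_re] at h1
  nlinarith

/-! ### Resolvent calculus on the negative half-line, through graphs -/

section Resolvents

variable {E : Type*} [NormedAddCommGroup E] [NormedSpace ℂ E] {A : E →ₗ.[ℂ] E}

theorem IsResolventAt.unique {z : ℂ} {R R' : E →L[ℂ] E} (h : IsResolventAt A z R)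
    (h' : IsResolventAt A z R') : R = R' := by
  ext x
  obtain ⟨hx, e⟩ := h.1 x
  have := h'.2 ⟨R x, hx⟩
  rw [e] at this
  exact this.symm

theorem IsResolventAt.resolventAt_eq {z : ℂ} {R : E →L[ℂ] E} (h : IsResolventAt A z R) :
    resolventAt A z = R := by
  have hex : ∃ R : E →L[ℂ] E, IsResolventAt A z R := ⟨R, h⟩
  rw [resolventAt, dif_pos hex]
  exact hex.choose_spec.unique h

/-- `R = (l + A)⁻¹` and `S = A (l + A)⁻¹`, in terms of the graph of `B`: the pair `(R, S)` maps
into the graph of `B`, and `R B ⊆ S`. -/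
structure Intertwines (B : E →ₗ.[ℂ] E) (R S : E →L[ℂ] E) : Prop where
  mem_graph : ∀ x, (R x, S x) ∈ B.graph
  apply_eq : ∀ x y, (x, y) ∈ B.graph → R y = S x
  comm : Commute R S

theorem mem_graph_opPow_succ {B : E →ₗ.[ℂ] E} {n : ℕ} {x z : E} :
    (x, z) ∈ (opPow B (n + 1)).graph ↔
      ∃ y, (x, y) ∈ B.graph ∧ (y, z) ∈ (opPow B n).graph := by
  constructor
  · intro h
    obtain ⟨⟨w, hw⟩, rfl, e⟩ := (LinearPMap.mem_graph_iff _).1 h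
    obtain ⟨h1, h2⟩ := mem_opPow_succ.1 hw
    refine ⟨B ⟨w, h1⟩, LinearPMap.mem_graph _ ⟨w, h1⟩, ?_⟩
    have e' : opPow B n ⟨B ⟨w, h1⟩, h2⟩ = z := e
    rw [← e']
    exact LinearPMap.mem_graph _ ⟨B ⟨w, h1⟩, h2⟩
  · rintro ⟨y, h1, h2⟩
    obtain ⟨⟨w, hw⟩, rfl, e⟩ := (LinearPMap.mem_graph_iff _).1 h1
    obtain ⟨⟨y', hy'⟩, e2, e3⟩ := (LinearPMap.mem_graph_iff _).1 h2
    simp only at e e2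
    subst e2
    subst e
    have hmem : w ∈ (opPow B (n + 1)).domain := mem_opPow_succ.2 ⟨hw, hy'⟩
    have e' : opPow B (n + 1) ⟨w, hmem⟩ = z := e3
    rw [← e']
    exact LinearPMap.mem_graph _ ⟨w, hmem⟩

/-- Both graph conditions iterate because `R` and `S` commute. Stated for a general operator, this
treats the powers of `A`, `A⁻¹` and `1 + A` at once. -/
theorem Intertwines.pow {B : E →ₗ.[ℂ] E} {R S : E →L[ℂ] E} (h : Intertwines B R S) (n : ℕ) :
    Intertwines (opPow B n) (R ^ n) (S ^ n) := by
  induction n with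
  | zero =>
    refine ⟨fun x => ?_, fun x y hxy => ?_, by simp⟩
    · exact LinearPMap.mem_graph (opPow B 0) ⟨x, Submodule.mem_top⟩
    · obtain ⟨w, rfl, e⟩ := (LinearPMap.mem_graph_iff _).1 hxy
      exact e.symm
  | succ n ih =>
    refine ⟨fun x => mem_graph_opPow_succ.2 ⟨S ((R ^ n) x), ?_, ?_⟩, ?_, h.comm.pow_pow _ _⟩
    · rw [pow_succ']
      exact h.mem_graph _
    · have e : S ((R ^ n) x) = (R ^ n) (S x) :=
        (DFunLike.congr_fun (h.comm.pow_left n).eq x).symm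
      rw [e, pow_succ]
      exact ih.mem_graph _
    · intro x z hxz
      obtain ⟨y, h1, h2⟩ := mem_graph_opPow_succ.1 hxz
      have e1 : (R ^ (n + 1)) z = R ((R ^ n) z) := by rw [pow_succ']; rfl
      have e2 : R ((S ^ n) y) = (S ^ n) (R y) := DFunLike.congr_fun (h.comm.pow_right n).eq y
      rw [e1, ih.apply_eq y z h2, e2, h.apply_eq x y h1, pow_succ]
      rfl

theorem Intertwines.exists_apply_eq {B : E →ₗ.[ℂ] E} {R S : E →L[ℂ] E} (h : Intertwines B R S)
    (x : E) : ∃ hx : R x ∈ B.domain, B ⟨R x, hx⟩ = S x := by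
  obtain ⟨⟨w, hw⟩, e, e'⟩ := (LinearPMap.mem_graph_iff _).1 (h.mem_graph x)
  simp only at e e'
  subst e
  exact ⟨hw, e'⟩

theorem Intertwines.toFun_eq {B : E →ₗ.[ℂ] E} {R S : E →L[ℂ] E} (h : Intertwines B R S)
    {x : E} {w : B.domain} (hw : (w : E) = R x) : B.toFun w = S x := by
  obtain ⟨hx, e⟩ := h.exists_apply_eq x
  rw [← e]
  congr 1
  exact Subtype.ext hw

theorem Intertwines.apply_toFun {B : E →ₗ.[ℂ] E} {R S : E →L[ℂ] E} (h : Intertwines B R S)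
    (w : B.domain) : R (B.toFun w) = S w :=
  h.apply_eq _ _ (LinearPMap.mem_graph B w)

/-- The half-line `(-∞, 0)` consists of regular points of `A`. -/
def NegRegular (A : E →ₗ.[ℂ] E) : Prop := ∀ l : ℝ, 0 < l → -(l : ℂ) ∈ resolventSetOf A

theorem IsSectorial.negRegular (hA : IsSectorial A) : NegRegular A := by
  obtain ⟨ω, hω⟩ := hA
  intro l hl
  by_contra h
  exact neg_notMem_closure_sector hω.nonneg hω.lt_pi hl (hω.spectrum_subset h)

theorem IsSectorial.exists_bound (hA : IsSectorial A) :
    ∃ M : ℝ, 0 ≤ M ∧ ∀ l : ℝ, 0 < l → ‖(l : ℂ) • plusInv A l‖ ≤ M := by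
  obtain ⟨ω, hω⟩ := hA
  -- Only the ray of argument `π` is needed, so any angle strictly between `ω` and `π` serves.
  obtain ⟨M, hM⟩ := hω.bound ((ω + Real.pi) / 2) (by linarith [hω.lt_pi]) (by linarith [hω.lt_pi])
  refine ⟨max M 0, le_max_right _ _, fun l hl => le_max_of_le_left ?_⟩
  have harg : (-(l : ℂ)).arg = Real.pi := by
    rw [← Complex.ofReal_neg]
    exact Complex.arg_ofReal_of_neg (by linarith)
  have := hM (-(l : ℂ)) (by rw [harg, abs_of_pos Real.pi_pos]; linarith [hω.lt_pi])
  simpa [plusInv] using this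

/-- The bounded operator `A (l + A)⁻¹ = 1 - l (l + A)⁻¹`. -/
def mulPlusInv (A : E →ₗ.[ℂ] E) (l : ℝ) : E →L[ℂ] E := 1 - (l : ℂ) • plusInv A l

/-- The bounded operator `(1 + A) (l + A)⁻¹ = 1 + (1 - l) (l + A)⁻¹`. -/
def idPlusPlusInv (A : E →ₗ.[ℂ] E) (l : ℝ) : E →L[ℂ] E := 1 + (1 - (l : ℂ)) • plusInv A l

variable (hA : NegRegular A)
include hA

theorem NegRegular.isResolventAt {l : ℝ} (hl : 0 < l) :
    IsResolventAt A (-(l : ℂ)) (-plusInv A l) := by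
  obtain ⟨R, hR⟩ := hA l hl
  rw [plusInv, neg_neg, hR.resolventAt_eq]
  exact hR

theorem NegRegular.intertwines {l : ℝ} (hl : 0 < l) :
    Intertwines A (plusInv A l) (mulPlusInv A l) := by
  have hR := hA.isResolventAt hl
  refine ⟨fun x => ?_, fun x y hxy => ?_, ?_⟩
  · obtain ⟨h, e⟩ := hR.1 x
    have h1 : ((-plusInv A l) x, A ⟨_, h⟩) ∈ A.graph := LinearPMap.mem_graph A ⟨_, h⟩
    have h2 := Submodule.neg_mem _ h1
    have e2 : A ⟨(-plusInv A l) x, h⟩ = -(mulPlusInv A l x) := by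
      have : A ⟨(-plusInv A l) x, h⟩ = -(l : ℂ) • (-plusInv A l) x - x := by
        nth_rewrite 3 [← e]
        abel
      rw [this, mulPlusInv]
      simp
    rw [e2] at h2
    simpa using h2
  · obtain ⟨w, rfl, rfl⟩ := (LinearPMap.mem_graph_iff _).1 hxy
    have := hR.2 w
    simp only [neg_apply, map_sub, map_smul, neg_smul, smul_neg, neg_neg, map_neg] at this
    simp only [mulPlusInv, sub_apply, one_apply_eq_self, smul_apply]
    rw [sub_neg_eq_add] at this
    rw [eq_sub_iff_add_eq, add_comm]
    exact this
  · exact (Commute.one_right _).sub_right ((Commute.refl _).smul_right _)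

theorem NegRegular.plusInv_sub_plusInv {l m : ℝ} (hl : 0 < l) (hm : 0 < m) :
    plusInv A l - plusInv A m = ((m : ℂ) - l) • (plusInv A l * plusInv A m) := by
  ext x
  have h1 := (hA.intertwines hl).apply_eq _ _ ((hA.intertwines hm).mem_graph x)
  simp only [mulPlusInv, sub_apply, one_apply_eq_self,
    smul_apply, map_sub, map_smul] at h1
  have e : (plusInv A l * plusInv A m) x = plusInv A l (plusInv A m x) := rfl
  simp only [sub_apply, smul_apply, sub_smul, e]
  rw [sub_eq_iff_eq_add] at h1 ⊢
  rw [h1]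
  abel

theorem NegRegular.commute {l m : ℝ} (hl : 0 < l) (hm : 0 < m) :
    Commute (plusInv A l) (plusInv A m) := by
  by_cases h : l = m
  · rw [h]
  have h1 := hA.plusInv_sub_plusInv hl hm
  have h2 := hA.plusInv_sub_plusInv hm hl
  have h3 : ((m : ℂ) - l) • (plusInv A l * plusInv A m)
      = ((m : ℂ) - l) • (plusInv A m * plusInv A l) := by
    rw [← h1, ← neg_sub, h2, ← neg_smul, neg_sub]
  have hne : (m : ℂ) - l ≠ 0 := by
    rw [sub_ne_zero]
    exact_mod_cast Ne.symm h
  exact smul_right_injective _ hne h3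

/-- The resolvent identity in multiplicative form. Together with `mulPlusInv_one_mul` it moves
statements from the base point `1`, where the spaces are defined, to an arbitrary `l`. -/
theorem NegRegular.plusInv_one_mul {l : ℝ} (hl : 0 < l) :
    plusInv A 1 * idPlusPlusInv A l = plusInv A l := by
  have h := hA.plusInv_sub_plusInv hl one_pos
  rw [(hA.commute hl one_pos).eq, Complex.ofReal_one] at h
  rw [idPlusPlusInv, mul_add, mul_one, mul_smul_comm, ← h]
  abel

theorem NegRegular.mulPlusInv_one_mul {l : ℝ} (hl : 0 < l) :
    mulPlusInv A 1 * idPlusPlusInv A l = mulPlusInv A l := by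
  have h := hA.plusInv_one_mul hl
  rw [mulPlusInv, sub_mul, one_mul, Complex.ofReal_one, one_smul, h, mulPlusInv, idPlusPlusInv,
    sub_smul, one_smul]
  abel

theorem NegRegular.plusInv_injective {l : ℝ} (hl : 0 < l) :
    Function.Injective (plusInv A l) := by
  rw [injective_iff_map_eq_zero]
  intro x hx
  have h := (hA.intertwines hl).mem_graph x
  rw [hx] at h
  have := LinearPMap.graph_fst_eq_zero_snd A h rfl
  simpa [mulPlusInv, hx] using this

theorem NegRegular.mulPlusInv_injective (hinj : Function.Injective A.toFun) {l : ℝ} (hl : 0 < l) :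
    Function.Injective (mulPlusInv A l) := by
  rw [injective_iff_map_eq_zero]
  intro x hx
  obtain ⟨h, e⟩ := (hA.intertwines hl).exists_apply_eq x
  rw [hx] at e
  have h0 := hinj (a₁ := ⟨_, h⟩) (a₂ := 0) (by rw [map_zero]; exact e)
  apply hA.plusInv_injective hl
  rw [map_zero]
  exact congrArg Subtype.val h0

/-- Inversion swaps the coordinates of the graph, and so exchanges the roles of `(l + A)⁻¹` and `A
(l + A)⁻¹`. -/
theorem NegRegular.intertwines_inverse (hinj : Function.Injective A.toFun) {l : ℝ} (hl : 0 < l) :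
    Intertwines A.inverse (mulPlusInv A l) (plusInv A l) := by
  have hker : LinearMap.ker A.toFun = ⊥ := LinearMap.ker_eq_bot.2 hinj
  have h := hA.intertwines hl
  have hg : ∀ x y, (x, y) ∈ A.inverse.graph ↔ (y, x) ∈ A.graph := by
    intro x y
    rw [LinearPMap.inverse_graph hker, Submodule.mem_map]
    constructor
    · rintro ⟨⟨a, b⟩, hab, e⟩
      obtain ⟨rfl, rfl⟩ := Prod.mk.inj e
      exact hab
    · exact fun h => ⟨(y, x), h, rfl⟩
  exact ⟨fun x => (hg _ _).2 (h.mem_graph x),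
    fun x y hxy => (h.apply_eq _ _ ((hg _ _).1 hxy)).symm, h.comm.symm⟩

theorem NegRegular.intertwines_idPlus {l : ℝ} (hl : 0 < l) :
    Intertwines (idPlus A) (plusInv A l) (idPlusPlusInv A l) := by
  have h := hA.intertwines hl
  have hg : ∀ x y, (x, y) ∈ (idPlus A).graph ↔ (x, y - x) ∈ A.graph := by
    intro x y
    simp only [LinearPMap.mem_graph_iff]
    constructor
    · rintro ⟨w, e, e'⟩
      refine ⟨w, e, ?_⟩
      have e1 : x + A w = y := by rw [← e']; exact congrArg (· + A w) e.symm
      rw [← e1]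
      exact (add_sub_cancel_left _ _).symm
    · rintro ⟨w, e, e'⟩
      refine ⟨w, e, ?_⟩
      have e2 : A w = y - x := e'
      have e3 : (w : E) + A w = y := by rw [e2]; exact e ▸ add_sub_cancel _ _
      exact e3
  have hT : idPlusPlusInv A l = plusInv A l + mulPlusInv A l := by
    rw [idPlusPlusInv, mulPlusInv, sub_smul, one_smul]
    abel
  refine ⟨fun x => (hg _ _).2 ?_, fun x y hxy => ?_, ?_⟩
  · have : idPlusPlusInv A l x - plusInv A l x = mulPlusInv A l x := by simp [hT]
    rw [this]
    exact h.mem_graph x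
  · have := h.apply_eq _ _ ((hg _ _).1 hxy)
    rw [hT, add_apply, ← this, map_sub]
    abel
  · rw [hT]
    exact (Commute.refl _).add_right h.comm

end Resolvents

/-! ### Completions of renormed spaces as closed subspaces -/

section Completion

variable {D D' E : Type*} [AddCommGroup D] [Module ℂ D] [AddCommGroup D'] [Module ℂ D']
  [NormedAddCommGroup E] [NormedSpace ℂ E]

theorem norm_toCompl (T : D →ₗ[ℂ] E) (d : D) : ‖toCompl T d‖ = ‖T d‖ :=
  UniformSpace.Completion.norm_coe (toRenorm T d)

theorem denseRange_toCompl (T : D →ₗ[ℂ] E) : DenseRange (toCompl T) :=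
  UniformSpace.Completion.denseRange_coe (α := Renorm T)

/-- `complMap` is meaningful only for uniformly continuous maps; the factorization `T' ∘ j = L ∘ T`
with `L` bounded supplies this continuity. -/
theorem complMap_toCompl {T : D →ₗ[ℂ] E} {T' : D' →ₗ[ℂ] E} {j : D →ₗ[ℂ] D'} {L : E →L[ℂ] E}
    (h : ∀ d, T' (j d) = L (T d)) (d : D) :
    complMap T T' j (toCompl T d) = toCompl T' (j d) := by
  have hu : UniformContinuous
      fun w : Renorm T => toRenorm T' (j ((toRenorm T).symm w)) := by
    refine AddMonoidHomClass.uniformContinuous_of_bound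
      ((toRenorm T').toLinearMap ∘ₗ j ∘ₗ (toRenorm T).symm.toLinearMap) ‖L‖ fun w => ?_
    have h1 := h ((toRenorm T).symm w)
    calc ‖T' (j ((toRenorm T).symm w))‖ = ‖L (T ((toRenorm T).symm w))‖ := by rw [h1]
      _ ≤ ‖L‖ * ‖T ((toRenorm T).symm w)‖ := L.le_opNorm _
  exact UniformSpace.Completion.map_coe hu (toRenorm T d)

/-- An operator that preserves the range of an isometry acts on its source. -/
theorem exists_conj_of_mapsTo_range {G : Type*} [NormedAddCommGroup G] [NormedSpace ℂ G]
    (Ψ : G →ₗᵢ[ℂ] E) (L : E →L[ℂ] E) (h : ∀ w, L (Ψ w) ∈ Set.range Ψ) :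
    ∃ L' : G →L[ℂ] G, ∀ w, Ψ (L' w) = L (Ψ w) := by
  choose f hf using h
  refine ⟨LinearMap.mkContinuous
    { toFun := f
      map_add' := fun x y => Ψ.injective (by simp [hf])
      map_smul' := fun c x => Ψ.injective (by simp [hf]) } ‖L‖ fun x => ?_, hf⟩
  rw [LinearMap.coe_mk, AddHom.coe_mk, ← Ψ.norm_map, hf, ← Ψ.norm_map x]
  exact L.le_opNorm _

variable [CompleteSpace E]

/-- The continuous extension of `T` to the completion for the norm `‖T ·‖`. -/
def complIsometry (T : D →ₗ[ℂ] E) : Compl T →ₗᵢ[ℂ] E where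
  toLinearMap := (T.extendOfNorm (toCompl T)).toLinearMap
  norm_map' w := by
    have h : ∃ C, ∀ x, ‖T x‖ ≤ C * ‖toCompl T x‖ :=
      ⟨1, fun x => by rw [one_mul, norm_toCompl]⟩
    refine (denseRange_toCompl T).induction_on w ?_ fun d => ?_
    · exact isClosed_eq (by fun_prop) continuous_norm
    · simp only [ContinuousLinearMap.coe_coe]
      rw [LinearMap.extendOfNorm_eq (denseRange_toCompl T) h, norm_toCompl]

@[simp]
theorem complIsometry_toCompl (T : D →ₗ[ℂ] E) (d : D) :
    complIsometry T (toCompl T d) = T d :=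
  LinearMap.extendOfNorm_eq (denseRange_toCompl T)
    ⟨1, fun x => by rw [one_mul, norm_toCompl]⟩ d

/-- An isometry from a complete space has closed range. This criterion decides which vectors of `X`
represent elements of a completion. -/
theorem range_complIsometry (T : D →ₗ[ℂ] E) :
    Set.range (complIsometry T) = closure (Set.range T) := by
  apply Set.Subset.antisymm
  · rintro _ ⟨w, rfl⟩
    refine (denseRange_toCompl T).induction_on (p := fun w => complIsometry T w ∈ _) w ?_ ?_
    · exact isClosed_closure.preimage (complIsometry T).continuous
    · intro d
      rw [complIsometry_toCompl]
      exact subset_closure ⟨d, rfl⟩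
  · refine closure_minimal ?_ (complIsometry T).isometry.isClosedEmbedding.isClosed_range
    rintro _ ⟨d, rfl⟩
    exact ⟨toCompl T d, complIsometry_toCompl T d⟩

theorem complIsometry_complMap {T : D →ₗ[ℂ] E} {T' : D' →ₗ[ℂ] E} {j : D →ₗ[ℂ] D'}
    {L : E →L[ℂ] E} (h : ∀ d, T' (j d) = L (T d)) (w : Compl T) :
    complIsometry T' (complMap T T' j w) = L (complIsometry T w) := by
  refine (denseRange_toCompl T).induction_on
    (p := fun w => complIsometry T' (complMap T T' j w) = L (complIsometry T w)) w ?_ ?_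
  · exact isClosed_eq
      ((complIsometry T').continuous.comp UniformSpace.Completion.continuous_map)
      (L.continuous.comp (complIsometry T).continuous)
  · intro d
    rw [complMap_toCompl h, complIsometry_toCompl, complIsometry_toCompl, h]

end Completion

/-! ### The extrapolation spaces inside `X` -/

section Scales

variable {X : Type*} [NormedAddCommGroup X] [NormedSpace ℂ X] {A : X →ₗ.[ℂ] X}

section

variable (hA : NegRegular A)
include hA

theorem NegRegular.opPow_plusInvPow {l : ℝ} (hl : 0 < l) (k : ℕ) (x : X) :
    (opPow A k).toFun (plusInvPow A l k x) = (mulPlusInv A l ^ k) x :=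
  ((hA.intertwines hl).pow k).toFun_eq rfl

theorem NegRegular.idPlusPow_plusInvPow {l : ℝ} (hl : 0 < l) (k : ℕ) (x : X) :
    idPlusPow A k (plusInvPow A l k x) = (idPlusPlusInv A l ^ k) x :=
  ((hA.intertwines_idPlus hl).pow k).toFun_eq rfl

theorem NegRegular.plusInv_pow_opPow {l : ℝ} (hl : 0 < l) (k : ℕ) (d : (opPow A k).domain) :
    (plusInv A l ^ k) ((opPow A k).toFun d) = (mulPlusInv A l ^ k) d :=
  ((hA.intertwines hl).pow k).apply_toFun d

theorem NegRegular.plusInv_pow_idPlusPow (k : ℕ) (d : (opPow A k).domain) :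
    (plusInv A 1 ^ k) (idPlusPow A k d) = d := by
  have h := ((hA.intertwines_idPlus one_pos).pow k).apply_toFun
    (Submodule.inclusion (opPow_domain_le_idPlus A k) d)
  rw [show idPlusPlusInv A 1 = 1 by simp [idPlusPlusInv], one_pow] at h
  exact h

theorem NegRegular.mulPlusInv_pow_invPow (hinj : Function.Injective A.toFun) {l : ℝ} (hl : 0 < l)
    (k : ℕ) (d : (invPow A k).domain) :
    (mulPlusInv A l ^ k) ((invPow A k).toFun d) = (plusInv A l ^ k) d :=
  ((hA.intertwines_inverse hinj hl).pow k).apply_toFun d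

theorem NegRegular.plusInv_pow_mem_range_invPow (hinj : Function.Injective A.toFun) {l : ℝ}
    (hl : 0 < l) (k : ℕ) (x : X) : (plusInv A l ^ k) x ∈ Set.range (invPow A k).toFun := by
  obtain ⟨h, e⟩ := ((hA.intertwines_inverse hinj hl).pow k).exists_apply_eq x
  exact ⟨⟨_, h⟩, e⟩

theorem NegRegular.regularizer_eq (k : ℕ) (x : X) :
    regularizer A k x = (mulPlusInv A 1 ^ k) ((plusInv A 1 ^ k) x) :=
  hA.opPow_plusInvPow one_pos k _

theorem NegRegular.regularizer_subtype_opPow (k : ℕ) (d : (opPow A k).domain) :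
    regularizer A k ((opPow A k).domain.subtype d)
      = (plusInv A 1 ^ k * plusInv A 1 ^ k) ((opPow A k).toFun d) := by
  have h : (mulPlusInv A 1 ^ k) ((plusInv A 1 ^ k) (d : X))
      = (plusInv A 1 ^ k) ((mulPlusInv A 1 ^ k) d) :=
    DFunLike.congr_fun (((hA.intertwines one_pos).comm.symm).pow_pow k k).eq (d : X)
  rw [hA.regularizer_eq, Submodule.subtype_apply, h, ← hA.plusInv_pow_opPow one_pos]
  rfl

theorem NegRegular.regularizer_subtype_invPow (hinj : Function.Injective A.toFun) (k : ℕ)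
    (d : (invPow A k).domain) :
    regularizer A k ((invPow A k).domain.subtype d)
      = (mulPlusInv A 1 ^ k * mulPlusInv A 1 ^ k) ((invPow A k).toFun d) := by
  rw [hA.regularizer_eq, Submodule.subtype_apply, ← hA.mulPlusInv_pow_invPow hinj one_pos]
  rfl

end

/-- Operators commuting with `(1 + A)⁻¹` preserve the range of `(1 + A)⁻ᵏ`, hence by continuity its
closure, the copy of `X_{-k}` in `X`. -/
theorem range_idPlusInvPow_mapsTo (k : ℕ) {L : X →L[ℂ] X} (hL : Commute L (plusInv A 1))
    {z : X} (hz : z ∈ closure (Set.range (idPlusInvPow A k))) :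
    L z ∈ closure (Set.range (idPlusInvPow A k)) := by
  refine map_mem_closure L.continuous hz ?_
  rintro _ ⟨x, rfl⟩
  exact ⟨L x, (DFunLike.congr_fun (hL.pow_right k).eq x).symm⟩

/-- The resolvent equations are closed conditions: they hold on the image of the graph of `A` and
pass to its closure by continuity and density. The isometry `Ψ` transfers injectivity of `(l + A)⁻¹`
to `R`. -/
theorem NegRegular.isResolventAt_closure_graph {G : Type*} [NormedAddCommGroup G]
    [NormedSpace ℂ G] (hA : NegRegular A) {l : ℝ} (hl : 0 < l) {Ψ : G →ₗᵢ[ℂ] X} {ι : X →ₗ[ℂ] G}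
    (hι : DenseRange ι) {R : G →L[ℂ] G} (hR : ∀ w, Ψ (R w) = plusInv A l (Ψ w))
    (hRι : ∀ x, R (ι x) = ι (plusInv A l x)) :
    IsResolventAt ((A.graph.map (ι.prodMap ι)).topologicalClosure).toLinearPMap (-(l : ℂ))
      (-R) := by
  set g := (A.graph.map (ι.prodMap ι)).topologicalClosure with hg
  have hg1 : ∀ p ∈ g, p.1 = R ((l : ℂ) • p.1 + p.2) := by
    intro p hp
    have hcl : IsClosed {p : G × G | p.1 = R ((l : ℂ) • p.1 + p.2)} :=
      isClosed_eq (by fun_prop) (by fun_prop)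
    refine closure_minimal ?_ hcl hp
    rintro _ ⟨⟨x, y⟩, hxy, rfl⟩
    simp only [Set.mem_ofPred_eq, LinearMap.prodMap_apply]
    rw [← map_smul, ← map_add, hRι, map_add, (hA.intertwines hl).apply_eq x y hxy]
    simp [mulPlusInv]
  have hg2 : ∀ v, (R v, v - (l : ℂ) • R v) ∈ g := by
    intro v
    refine hι.induction_on (p := fun v => (R v, v - (l : ℂ) • R v) ∈ g) v ?_ fun x => ?_
    · exact (Submodule.isClosed_topologicalClosure _).preimage
        (f := fun v => (R v, v - (l : ℂ) • R v)) (by fun_prop)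
    · refine Submodule.le_topologicalClosure _ ⟨_, (hA.intertwines hl).mem_graph x, ?_⟩
      simp [hRι, mulPlusInv]
  -- `toLinearPMap` recovers the closure only if that closure is single-valued. A pair `(0, v)` in
  -- it satisfies `R v = 0`, hence `v = 0`.
  have hgraph : g.toLinearPMap.graph = g := by
    refine Submodule.toLinearPMap_graph_eq _ fun p hp hp0 => ?_
    have h1 := hg1 p hp
    rw [hp0, smul_zero, zero_add] at h1
    have h2 := hR p.2
    rw [← h1, map_zero] at h2
    have h3 := hA.plusInv_injective hl (h2.symm.trans (map_zero _).symm)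
    exact Ψ.injective (h3.trans (map_zero _).symm)
  constructor
  · intro v
    have h1 : (R v, v - (l : ℂ) • R v) ∈ g.toLinearPMap.graph := by
      rw [hgraph]
      exact hg2 v
    obtain ⟨⟨w, hw⟩, e, e'⟩ := (LinearPMap.mem_graph_iff _).1 (Submodule.neg_mem _ h1)
    simp only [Prod.neg_mk] at e e'
    have e3 : (-R) v = w := e.symm
    subst e3
    refine ⟨hw, ?_⟩
    rw [e']
    simp
  · intro w
    have h1 : ((w : G), g.toLinearPMap w) ∈ g := by
      have := LinearPMap.mem_graph g.toLinearPMap w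
      rwa [hgraph] at this
    have h2 := (hg1 _ h1).symm
    simp only at h2
    refine Eq.trans ?_ h2
    rw [neg_apply, ← map_neg]
    congr 1
    simp [add_comm]

theorem NegRegular.embXDotPos_toCompl (hA : NegRegular A) (k : ℕ) (d : (opPow A k).domain) :
    embXDotPos A k (toCompl _ d) = embX A k d :=
  complMap_toCompl (fun d => hA.regularizer_subtype_opPow k d) d

variable [CompleteSpace X]

/-- With the three analogues that follow, this turns equations in the ambient space into equations
between bounded operators on `X`. -/
theorem NegRegular.complIsometry_embX (hA : NegRegular A) (k : ℕ) (x : X) :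
    complIsometry (regularizer A k) (embX A k x) = (mulPlusInv A 1 ^ k) ((plusInv A 1 ^ k) x) := by
  rw [embX, complIsometry_toCompl, hA.regularizer_eq]

theorem NegRegular.complIsometry_embXNeg (hA : NegRegular A) (k : ℕ) (w : XNeg A k) :
    complIsometry (regularizer A k) (embXNeg A k w)
      = (mulPlusInv A 1 ^ k) (complIsometry (idPlusInvPow A k) w) :=
  complIsometry_complMap (T := idPlusInvPow A k) (T' := regularizer A k) (j := LinearMap.id)
    (fun d => hA.regularizer_eq k d) w

theorem NegRegular.complIsometry_embXDotPos (hA : NegRegular A) (k : ℕ) (w : XDotPos A k) :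
    complIsometry (regularizer A k) (embXDotPos A k w)
      = (plusInv A 1 ^ k * plusInv A 1 ^ k) (complIsometry (opPow A k).toFun w) :=
  complIsometry_complMap (fun d => hA.regularizer_subtype_opPow k d) w

theorem NegRegular.complIsometry_embXDotNeg (hA : NegRegular A)
    (hinj : Function.Injective A.toFun) (k : ℕ) (w : XDotNeg A k) :
    complIsometry (regularizer A k) (embXDotNeg A k w)
      = (mulPlusInv A 1 ^ k * mulPlusInv A 1 ^ k) (complIsometry (invPow A k).toFun w) :=
  complIsometry_complMap (fun d => hA.regularizer_subtype_invPow hinj k d) w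

/-- The resolvent of the extrapolated operator is the restriction of the resolvent of `A`. -/
theorem NegRegular.complIsometry_plusInv_extrapolated (hA : NegRegular A) (k : ℕ) {l : ℝ}
    (hl : 0 < l) (w : XNeg A k) :
    complIsometry (idPlusInvPow A k) (plusInv (extrapolated A k) l w)
      = plusInv A l (complIsometry (idPlusInvPow A k) w) := by
  obtain ⟨R, hR⟩ := exists_conj_of_mapsTo_range (complIsometry (idPlusInvPow A k)) (plusInv A l)
    (fun w => by
      rw [range_complIsometry]
      apply range_idPlusInvPow_mapsTo k (hA.commute hl one_pos)
      rw [← range_complIsometry]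
      exact ⟨w, rfl⟩)
  have hι : ∀ x, complIsometry (idPlusInvPow A k) (toXNeg A k x) = (plusInv A 1 ^ k) x :=
    fun x => complIsometry_toCompl _ x
  have hRι : ∀ x, R (toXNeg A k x) = toXNeg A k (plusInv A l x) := by
    intro x
    apply (complIsometry (idPlusInvPow A k)).injective
    rw [hR, hι, hι]
    exact DFunLike.congr_fun ((hA.commute hl one_pos).pow_right k).eq x
  have hres : IsResolventAt (extrapolated A k) (-(l : ℂ)) (-R) :=
    hA.isResolventAt_closure_graph hl (denseRange_toCompl _) hR hRι
  rw [plusInv, hres.resolventAt_eq, neg_neg, hR]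

theorem NegRegular.complIsometry_plusInv_extrapolated_pow (hA : NegRegular A) (k n : ℕ) {l : ℝ}
    (hl : 0 < l) (w : XNeg A k) :
    complIsometry (idPlusInvPow A k) ((plusInv (extrapolated A k) l ^ n) w)
      = (plusInv A l ^ n) (complIsometry (idPlusInvPow A k) w) := by
  induction n with
  | zero => rfl
  | succ n ih =>
    rw [pow_succ', pow_succ']
    exact (hA.complIsometry_plusInv_extrapolated k hl _).trans (congrArg _ ih)

end Scales

/-! ### Polynomials in the scaled resolvent -/

section Polynomials

open Polynomial

/-- The normalized primitive of `X ^ (k - 1) * (1 - X) ^ (k - 1)`. -/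
theorem exists_beta_polynomial {k : ℕ} (hk : 1 ≤ k) :
    ∃ (Q p q : ℂ[X]) (c : ℂ), Q = X ^ k * q ∧ 1 - Q = (1 - X) ^ k * p ∧
      derivative Q = C c * (X ^ (k - 1) * (1 - X) ^ (k - 1)) := by
  obtain ⟨m, rfl⟩ := Nat.exists_eq_add_of_le' hk
  rw [Nat.add_sub_cancel]
  set b := bernsteinPolynomial ℂ (2 * m + 1) with hb
  -- `Q` is the upper half of the Bernstein partition of unity of degree `2m + 1`. Indices above `m`
  -- give the factor `X^(m+1)`, the remaining ones give `(1 - X)^(m+1)`, and the derivative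
  -- telescopes to the middle polynomial of degree `2m`.
  set Q := ∑ j ∈ Finset.range (m + 1), b (m + j + 1) with hQ
  have h1 : X ^ (m + 1) ∣ Q := by
    refine Finset.dvd_sum fun j _ => ?_
    rw [hb, bernsteinPolynomial]
    exact Dvd.dvd.mul_right (Dvd.dvd.mul_left (pow_dvd_pow _ (by omega)) _) _
  have h2 : (1 - X) ^ (m + 1) ∣ 1 - Q := by
    have hsum : 1 - Q = ∑ j ∈ Finset.range (m + 1), b j := by
      have h := bernsteinPolynomial.sum ℂ (2 * m + 1)
      rw [show 2 * m + 1 + 1 = (m + 1) + (m + 1) by ring, Finset.sum_range_add] at h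
      have e : Q = ∑ j ∈ Finset.range (m + 1), b (m + 1 + j) :=
        Finset.sum_congr rfl fun j _ => by rw [show m + j + 1 = m + 1 + j by omega]
      rw [e]
      exact (eq_sub_of_add_eq h).symm
    rw [hsum]
    refine Finset.dvd_sum fun j hj => ?_
    rw [hb, bernsteinPolynomial]
    exact Dvd.dvd.mul_left (pow_dvd_pow _ (by have := Finset.mem_range.1 hj; omega)) _
  have h3 : derivative Q
      = C (((2 * m + 1 : ℕ) : ℂ) * ((2 * m).choose m : ℕ)) * (X ^ m * (1 - X) ^ m) := by
    have hterm : ∀ j ∈ Finset.range (m + 1), derivative (b (m + j + 1))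
        = ((2 * m + 1 : ℕ) : ℂ[X]) * (bernsteinPolynomial ℂ (2 * m) (m + j)
          - bernsteinPolynomial ℂ (2 * m) (m + (j + 1))) := by
      intro j _
      rw [hb, bernsteinPolynomial.derivative_succ]
      simp [add_assoc]
    rw [hQ, derivative_sum, Finset.sum_congr rfl hterm, ← Finset.mul_sum,
      Finset.sum_range_sub' (fun j => bernsteinPolynomial ℂ (2 * m) (m + j)),
      bernsteinPolynomial.eq_zero_of_lt ℂ (show 2 * m < m + (m + 1) by omega), sub_zero, add_zero,
      bernsteinPolynomial, show 2 * m - m = m by omega, C_mul, C_eq_natCast, C_eq_natCast]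
    ring
  obtain ⟨q, hq⟩ := h1
  obtain ⟨p, hp⟩ := h2
  exact ⟨Q, p, q, _, hq, hp, h3⟩

variable {𝔸 : Type*} [NormedRing 𝔸] [NormedAlgebra ℂ 𝔸]

/-- The bound depends only on the radius `M`, so for `s = l (l + A)⁻¹` it is uniform in `l`. -/
theorem exists_norm_aeval_le (p : ℂ[X]) (M : ℝ) :
    ∃ c : ℝ, 0 ≤ c ∧ ∀ s : 𝔸, ‖s‖ ≤ M → ‖aeval s p‖ ≤ c := by
  induction p using Polynomial.induction_on with
  | C a => exact ⟨‖algebraMap ℂ 𝔸 a‖, norm_nonneg _, fun s _ => by rw [aeval_C]⟩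
  | add p q hp hq =>
    obtain ⟨c, hc, h⟩ := hp
    obtain ⟨d, hd, h'⟩ := hq
    refine ⟨c + d, by positivity, fun s hs => ?_⟩
    rw [map_add]
    exact (norm_add_le _ _).trans (add_le_add (h s hs) (h' s hs))
  | monomial n a ih =>
    obtain ⟨c, hc, h⟩ := ih
    refine ⟨c * |M|, by positivity, fun s hs => ?_⟩
    rw [pow_succ, ← mul_assoc, map_mul, aeval_X]
    exact (norm_mul_le _ _).trans
      (mul_le_mul (h s hs) (hs.trans (le_abs_self _)) (norm_nonneg _) hc)

/-- In a noncommutative algebra the usual chain rule needs the value of `s` to commute with its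
derivative, so that the factors `s'` can be collected on the right. -/
theorem hasDerivAt_aeval {s : ℝ → 𝔸} {s' : 𝔸} {t : ℝ} (hs : HasDerivAt s s' t)
    (hc : Commute (s t) s') (p : ℂ[X]) :
    HasDerivAt (fun t => aeval (s t) p) (aeval (s t) (derivative p) * s') t := by
  induction p using Polynomial.induction_on with
  | C a => simpa using hasDerivAt_const t (algebraMap ℂ 𝔸 a)
  | add p q hp hq =>
    simp only [map_add, add_mul]
    exact hp.add hq
  | monomial n a ih =>
    have h := ih.mul hs
    rw [pow_succ, ← mul_assoc, derivative_mul, derivative_X, mul_one, map_add, map_mul, aeval_X,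
      add_mul, mul_assoc _ (s t) s', hc.eq, ← mul_assoc]
    simp only [map_mul _ _ X, aeval_X]
    exact h

end Polynomials

/-! ### Differentiating the resolvent in `l` -/

section ResolventCalculus

variable {E : Type*} [NormedAddCommGroup E] [NormedSpace ℂ E] {A : E →ₗ.[ℂ] E}

/-- The resolvent identity gives a factor `|l - m|`, while the resolvents stay bounded near `l` by
`‖(m + A)⁻¹‖ ≤ M / m`. -/
theorem NegRegular.continuousAt_plusInv (hA : NegRegular A) {M : ℝ}
    (hM : ∀ l : ℝ, 0 < l → ‖(l : ℂ) • plusInv A l‖ ≤ M) {l : ℝ} (hl : 0 < l) :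
    ContinuousAt (plusInv A) l := by
  have hlim : Filter.Tendsto (fun m : ℝ => |l - m| * (M / m * ‖plusInv A l‖)) (nhds l)
      (nhds (|l - l| * (M / l * ‖plusInv A l‖))) := by
    have : ContinuousAt (fun m : ℝ => |l - m| * (M / m * ‖plusInv A l‖)) l := by
      have := hl.ne'
      fun_prop (disch := assumption)
    exact this
  rw [sub_self, abs_zero, zero_mul] at hlim
  rw [ContinuousAt, tendsto_iff_norm_sub_tendsto_zero]
  refine squeeze_zero' (Filter.Eventually.of_forall fun _ => norm_nonneg _) ?_ hlim
  filter_upwards [lt_mem_nhds hl] with m hm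
  rw [hA.plusInv_sub_plusInv hm hl, norm_smul]
  have h1 : ‖plusInv A m‖ ≤ M / m := by
    have := hM m hm
    rw [norm_smul, Complex.norm_real, Real.norm_of_nonneg hm.le] at this
    rw [le_div_iff₀ hm]
    linarith
  have h2 : ‖(l : ℂ) - m‖ = |l - m| := by
    rw [← Complex.ofReal_sub, Complex.norm_real, Real.norm_eq_abs]
  rw [h2]
  gcongr
  exact (norm_mul_le _ _).trans (by gcongr)

theorem NegRegular.hasDerivAt_plusInv (hA : NegRegular A) {M : ℝ}
    (hM : ∀ l : ℝ, 0 < l → ‖(l : ℂ) • plusInv A l‖ ≤ M) {l : ℝ} (hl : 0 < l) :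
    HasDerivAt (plusInv A) (-(plusInv A l * plusInv A l)) l := by
  rw [hasDerivAt_iff_tendsto_slope]
  have hc : Filter.Tendsto (fun m => -(plusInv A m * plusInv A l)) (nhdsWithin l {l}ᶜ)
      (nhds (-(plusInv A l * plusInv A l))) :=
    (((hA.continuousAt_plusInv hM hl).tendsto.mul_const _).neg).mono_left nhdsWithin_le_nhds
  refine hc.congr' ?_
  filter_upwards [self_mem_nhdsWithin, mem_nhdsWithin_of_mem_nhds (lt_mem_nhds hl)] with m hne hm
  have hne' : m - l ≠ 0 := sub_ne_zero.2 hne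
  rw [slope, vsub_eq_sub, hA.plusInv_sub_plusInv hm hl,
    show ((l : ℂ) - m) = ((-(m - l) : ℝ) : ℂ) by push_cast; ring, Complex.coe_smul, smul_smul]
  rw [show (m - l)⁻¹ * -(m - l) = -1 by field_simp, neg_smul, one_smul]

/-- The bounded operator `l (l + A)⁻¹`. -/
def scaledPlusInv (A : E →ₗ.[ℂ] E) (l : ℝ) : E →L[ℂ] E := (l : ℂ) • plusInv A l

theorem mulPlusInv_eq (l : ℝ) : mulPlusInv A l = 1 - scaledPlusInv A l := rfl

/-- The logistic equation `l s' = s (1 - s)`: it is what makes the derivative of a polynomial in `s`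
again a polynomial in `s`, up to the factor `l⁻¹`. -/
theorem NegRegular.hasDerivAt_scaledPlusInv (hA : NegRegular A) {M : ℝ}
    (hM : ∀ l : ℝ, 0 < l → ‖(l : ℂ) • plusInv A l‖ ≤ M) {l : ℝ} (hl : 0 < l) :
    HasDerivAt (scaledPlusInv A) (l⁻¹ • (scaledPlusInv A l * mulPlusInv A l)) l := by
  have h := (hasDerivAt_id l).smul (hA.hasDerivAt_plusInv hM hl)
  have e : l⁻¹ • (scaledPlusInv A l * mulPlusInv A l)
      = id l • -(plusInv A l * plusInv A l) + (1 : ℝ) • plusInv A l := by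
    rw [mulPlusInv, scaledPlusInv, Complex.coe_smul, smul_mul_assoc, smul_smul,
      inv_mul_cancel₀ hl.ne', one_smul, one_smul, mul_sub, mul_one, mul_smul_comm, id, smul_neg]
    abel
  rw [e]
  exact h

open Polynomial in
/-- The derivative of `t ↦ Q (l (l + A)⁻¹)` for `l = t ^ (-1 / k)` and `Q` a primitive of
`c X ^ (k - 1) (1 - X) ^ (k - 1)`. -/
theorem NegRegular.hasDerivAt_aeval_scaledPlusInv (hA : NegRegular A) {M : ℝ}
    (hM : ∀ l : ℝ, 0 < l → ‖(l : ℂ) • plusInv A l‖ ≤ M) {Q : ℂ[X]} {c : ℂ} {m : ℕ}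
    (hQ : derivative Q = C c * (X ^ m * (1 - X) ^ m)) {a t : ℝ} (ht : 0 < t) :
    HasDerivAt (fun t => aeval (scaledPlusInv A (t ^ a)) Q)
      ((a * t⁻¹) • c • (scaledPlusInv A (t ^ a) ^ (m + 1) * mulPlusInv A (t ^ a) ^ (m + 1))) t := by
  have hl : 0 < t ^ a := Real.rpow_pos_of_pos ht a
  have hcomm : Commute (scaledPlusInv A (t ^ a)) (mulPlusInv A (t ^ a)) := by
    rw [mulPlusInv_eq]
    exact (Commute.one_right _).sub_right (Commute.refl _)
  have h1 := (hA.hasDerivAt_scaledPlusInv hM hl).scomp t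
    (Real.hasDerivAt_rpow_const (p := a) (Or.inl ht.ne'))
  have h2 := hasDerivAt_aeval h1 (((((Commute.refl _).mul_right hcomm).smul_right _)).smul_right _) Q
  refine h2.congr_deriv ?_
  have e : a * t ^ (a - 1) * (t ^ a)⁻¹ = a * t⁻¹ := by
    rw [Real.rpow_sub_one ht.ne']
    field_simp
  simp only [Function.comp_apply]
  rw [hQ, smul_smul, e, mul_smul_comm]
  congr 1
  simp only [map_mul, map_pow, map_sub, map_one, aeval_X, aeval_C]
  rw [← mulPlusInv_eq, ← Algebra.smul_def, smul_mul_assoc]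
  congr 1
  -- The factor `s (1 - s)` from the logistic equation raises both exponents of `Q'` from `m` to `m
  -- + 1`.
  rw [mul_assoc, ← mul_assoc (mulPlusInv A (t ^ a) ^ m), ((hcomm.pow_right m).eq).symm, pow_succ,
    pow_succ]
  simp only [mul_assoc]

end ResolventCalculus

/-! ### Estimates for the K-functional and the interpolation norms -/

section Interpolation

variable {E₀ E₁ V F : Type*} [NormedAddCommGroup E₀] [NormedAddCommGroup E₁] [AddCommGroup V]
  [SeminormedAddCommGroup F]

theorem enorm_le_mul_kFunctional {i₀ : E₀ → V} {i₁ : E₁ → V} {t c : ℝ} {v : V} {x : F}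
    (hc : 0 < c) (ht : 0 ≤ t)
    (h : ∀ a b, i₀ a + i₁ b = v → ‖x‖ ≤ c * (‖a‖ + t * ‖b‖)) :
    ‖x‖ₑ ≤ ENNReal.ofReal c * kFunctional i₀ i₁ t v := by
  have hc0 : ENNReal.ofReal c ≠ 0 := by simpa using hc
  -- Dividing by `c` leaves the infimum alone on the right, so that it can be tested decomposition
  -- by decomposition.
  rw [mul_comm, ← ENNReal.div_le_iff_le_mul (Or.inl hc0) (Or.inl ENNReal.ofReal_ne_top)]
  refine le_iInf fun a => le_iInf fun b => le_iInf fun hab => ?_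
  rw [ENNReal.div_le_iff_le_mul (Or.inl hc0) (Or.inl ENNReal.ofReal_ne_top),
    ← ofReal_norm, ← ofReal_norm, ← ofReal_norm, ← ENNReal.ofReal_mul ht,
    ← ENNReal.ofReal_add (norm_nonneg _) (by positivity), mul_comm, ← ENNReal.ofReal_mul hc.le]
  exact ENNReal.ofReal_le_ofReal (h a b hab)

theorem kFunctional_le {i₀ : E₀ → V} {i₁ : E₁ → V} {t r : ℝ} {v : V} (ht : 0 ≤ t) (a : E₀)
    (b : E₁) (hab : i₀ a + i₁ b = v) (h : ‖a‖ + t * ‖b‖ ≤ r) :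
    kFunctional i₀ i₁ t v ≤ ENNReal.ofReal r := by
  refine (iInf_le_of_le a (iInf_le_of_le b (iInf_le_of_le hab le_rfl))).trans ?_
  rw [← ofReal_norm, ← ofReal_norm, ← ENNReal.ofReal_mul ht,
    ← ENNReal.ofReal_add (norm_nonneg _) (by positivity)]
  exact ENNReal.ofReal_le_ofReal h

theorem interpNorm_top (i₀ : E₀ → V) (i₁ : E₁ → V) (θ : ℝ) (v : V) :
    interpNorm i₀ i₁ θ ∞ v
      = ⨆ (t : ℝ) (_ : 0 < t), ENNReal.ofReal (t ^ (-θ)) * kFunctional i₀ i₁ t v :=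
  if_pos rfl

theorem interpNorm_one (i₀ : E₀ → V) (i₁ : E₁ → V) (θ : ℝ) (v : V) :
    interpNorm i₀ i₁ θ 1 v
      = ∫⁻ t in Set.Ioi (0 : ℝ),
          ENNReal.ofReal (t ^ (-θ)) * kFunctional i₀ i₁ t v * ENNReal.ofReal t⁻¹ := by
  rw [interpNorm, if_neg ENNReal.one_ne_top]
  simp

/-- `∫₀^∞ t^{-θ} min(τ, t) dt/t` is a multiple of `τ^{1-θ}`. -/
theorem interpNorm_one_le {i₀ : E₀ → V} {i₁ : E₁ → V} {θ r τ : ℝ} {v : V} (hθ₀ : 0 < θ)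
    (hθ₁ : θ < 1) (hτ : 0 < τ) (hr : 0 ≤ r)
    (h : ∀ t, 0 < t → kFunctional i₀ i₁ t v ≤ ENNReal.ofReal (r * min τ t)) :
    interpNorm i₀ i₁ θ 1 v ≤ ENNReal.ofReal (r * (1 / (1 - θ) + 1 / θ) * τ ^ (1 - θ)) := by
  -- The weights combine to `min(τ, t) t^{-θ-1}`: near `0` this is `t^{-θ}`, integrable since `θ <
  -- 1`; beyond `τ` it is `τ t^{-θ-1}`, integrable since `θ > 0`.
  have hpt : ∀ t, 0 < t → ENNReal.ofReal (t ^ (-θ)) * kFunctional i₀ i₁ t v * ENNReal.ofReal t⁻¹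
      ≤ ENNReal.ofReal (r * (min τ t * t ^ (-θ - 1))) := by
    intro t ht
    refine (mul_le_mul_left (mul_le_mul_right (h t ht) _) _).trans_eq ?_
    rw [← ENNReal.ofReal_mul (by positivity), ← ENNReal.ofReal_mul (by positivity),
      Real.rpow_sub_one ht.ne']
    congr 1
    ring
  have hI1 : ∫⁻ t in Set.Ioc 0 τ, ENNReal.ofReal (r * (min τ t * t ^ (-θ - 1)))
      = ENNReal.ofReal (r * (τ ^ (1 - θ) / (1 - θ))) := by
    have hint : IntervalIntegrable (fun t : ℝ => t ^ (-θ)) volume 0 τ :=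
      intervalIntegral.intervalIntegrable_rpow' (by linarith)
    have e1 : ∫⁻ t in Set.Ioc 0 τ, ENNReal.ofReal (r * (min τ t * t ^ (-θ - 1)))
        = ∫⁻ t in Set.Ioc 0 τ, ENNReal.ofReal (r * t ^ (-θ)) := by
      refine setLIntegral_congr_fun measurableSet_Ioc fun t ht => ?_
      rw [min_eq_right ht.2, Real.rpow_sub_one ht.1.ne', mul_div_cancel₀ _ ht.1.ne']
    rw [e1, ← ofReal_integral_eq_lintegral_ofReal (hint.1.const_mul r), integral_const_mul,
      ← intervalIntegral.integral_of_le hτ.le, integral_rpow (Or.inl (by linarith)),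
      Real.zero_rpow (by linarith)]
    · congr 3
      · rw [sub_zero]
        congr 1
        ring
      · ring
    · filter_upwards [ae_restrict_mem measurableSet_Ioc] with t ht
      have := ht.1
      positivity
  have hI2 : ∫⁻ t in Set.Ioi τ, ENNReal.ofReal (r * (min τ t * t ^ (-θ - 1)))
      = ENNReal.ofReal (r * (τ ^ (1 - θ) / θ)) := by
    have e1 : ∫⁻ t in Set.Ioi τ, ENNReal.ofReal (r * (min τ t * t ^ (-θ - 1)))
        = ∫⁻ t in Set.Ioi τ, ENNReal.ofReal (r * τ * t ^ (-θ - 1)) := by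
      refine setLIntegral_congr_fun measurableSet_Ioi fun t ht => ?_
      rw [min_eq_left (le_of_lt ht), mul_assoc]
    rw [e1, ← ofReal_integral_eq_lintegral_ofReal
      ((integrableOn_Ioi_rpow_of_lt (by linarith) hτ).const_mul _), integral_const_mul,
      integral_Ioi_rpow_of_lt (by linarith) hτ]
    · congr 1
      rw [show -θ - 1 + 1 = -θ by ring, sub_eq_add_neg 1 θ, Real.rpow_add hτ, Real.rpow_one]
      field_simp
    · filter_upwards [ae_restrict_mem measurableSet_Ioi] with t ht
      have : 0 < t := hτ.trans ht
      positivity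
  rw [interpNorm_one, ← Set.Ioc_union_Ioi_eq_Ioi hτ.le,
    lintegral_union measurableSet_Ioi (Set.Ioc_disjoint_Ioi le_rfl)]
  have h1 := (setLIntegral_mono' measurableSet_Ioc fun t ht => hpt t ht.1).trans_eq hI1
  have h2 := (setLIntegral_mono' measurableSet_Ioi fun t ht => hpt t (hτ.trans ht)).trans_eq hI2
  refine (add_le_add h1 h2).trans_eq ?_
  have h3 : 0 < 1 - θ := by linarith
  rw [← ENNReal.ofReal_add (by positivity) (by positivity)]
  congr 1
  ring

end Interpolation

/-- The substitution `l = t^{-1/k}`, that is `t = l^{-k}`, links the resolvent parameter to the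
parameter of the K-functional. -/
theorem rpow_neg_one_div_pow {k : ℕ} (hk : 1 ≤ k) {t : ℝ} (ht : 0 < t) :
    (t ^ (-(1 / (k : ℝ)))) ^ k = t⁻¹ := by
  have : (k : ℝ) ≠ 0 := by positivity
  rw [← Real.rpow_natCast, ← Real.rpow_mul ht.le, show -(1 / (k : ℝ)) * k = -1 by field_simp,
    Real.rpow_neg_one]

/-! ### The K-functional of `(Ẋ_{-k}, X)` and the resolvent powers -/

section Control

variable {X : Type*} [NormedAddCommGroup X] [NormedSpace ℂ X] {A : X →ₗ.[ℂ] X}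

theorem scaledPlusInv_pow (A : X →ₗ.[ℂ] X) (l : ℝ) (k : ℕ) :
    scaledPlusInv A l ^ k = ((l ^ k : ℝ) : ℂ) • plusInv A l ^ k := by
  rw [scaledPlusInv, smul_pow, Complex.ofReal_pow]

theorem commute_aeval (r : Polynomial ℂ) {L : X →L[ℂ] X} {l : ℝ} (hL : Commute L (plusInv A l)) :
    Commute L (Polynomial.aeval (scaledPlusInv A l) r) := by
  induction r using Polynomial.induction_on with
  | C a =>
    rw [Polynomial.aeval_C]
    exact (Algebra.commutes a L).symm
  | add p q hp hq => rw [map_add]; exact hp.add_right hq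
  | monomial n a ih =>
    rw [pow_succ, ← mul_assoc, map_mul, Polynomial.aeval_X]
    exact ih.mul_right (hL.smul_right _)

theorem NegRegular.commute_mulPlusInv (hA : NegRegular A) {l m : ℝ} (hl : 0 < l) (hm : 0 < m) :
    Commute (plusInv A l) (mulPlusInv A m) :=
  (Commute.one_right _).sub_right ((hA.commute hl hm).smul_right _)

theorem NegRegular.commute_idPlusPlusInv (hA : NegRegular A) {l m : ℝ} (hl : 0 < l)
    (hm : 0 < m) : Commute (plusInv A l) (idPlusPlusInv A m) :=
  (Commute.one_right _).add_right ((hA.commute hl hm).smul_right _)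

theorem NegRegular.plusInv_one_pow_mul (hA : NegRegular A) {l : ℝ} (hl : 0 < l) (k : ℕ) :
    plusInv A 1 ^ k * idPlusPlusInv A l ^ k = plusInv A l ^ k := by
  rw [← (hA.commute_idPlusPlusInv one_pos hl).mul_pow, hA.plusInv_one_mul hl]

theorem NegRegular.mulPlusInv_one_pow_mul (hA : NegRegular A) {l : ℝ} (hl : 0 < l) (k : ℕ) :
    mulPlusInv A 1 ^ k * idPlusPlusInv A l ^ k = mulPlusInv A l ^ k := by
  have h : Commute (mulPlusInv A 1) (idPlusPlusInv A l) :=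
    (Commute.one_left _).sub_left ((hA.commute_idPlusPlusInv one_pos hl).smul_left _)
  rw [← h.mul_pow, hA.mulPlusInv_one_mul hl]

theorem injective_pow {L : X →L[ℂ] X} (hL : Function.Injective L) (k : ℕ) :
    Function.Injective (L ^ k) := by
  induction k with
  | zero => exact fun _ _ h => h
  | succ k ih =>
    intro x y h
    rw [pow_succ'] at h
    exact ih (hL h)

variable [CompleteSpace X]

/-- Decompositions of an element of `X_{-k}` in the couple `(Ẋ_{-k}, X)`. -/
theorem NegRegular.embXDotNeg_add_embX_iff (hA : NegRegular A)
    (hinj : Function.Injective A.toFun) (k : ℕ) (a : XDotNeg A k) (b : X) (w : XNeg A k) :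
    embXDotNeg A k a + embX A k b = embXNeg A k w ↔
      (mulPlusInv A 1 ^ k) (complIsometry (invPow A k).toFun a) + (plusInv A 1 ^ k) b
        = complIsometry (idPlusInvPow A k) w := by
  -- Read in `X`, both sides carry a common factor `D_1^k`; it cancels because `A` is injective.
  rw [← (complIsometry (regularizer A k)).injective.eq_iff, map_add,
    hA.complIsometry_embXDotNeg hinj, hA.complIsometry_embX, hA.complIsometry_embXNeg,
    mul_apply_eq_comp, ← map_add,
    (injective_pow (hA.mulPlusInv_injective hinj one_pos) k).eq_iff]

/-- Decompositions of an element of `X` in the couple `(X, Ẋ_k)`. -/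
theorem NegRegular.embX_add_embXDotPos (hA : NegRegular A) {k : ℕ} {a : X} {b : XDotPos A k}
    {x : X} (h : embX A k a + embXDotPos A k b = embX A k x) {l : ℝ} (hl : 0 < l) :
    (mulPlusInv A l ^ k) x
      = (mulPlusInv A l ^ k) a + (plusInv A l ^ k) (complIsometry (opPow A k).toFun b) := by
  rw [← (complIsometry (regularizer A k)).injective.eq_iff, map_add,
    hA.complIsometry_embXDotPos, hA.complIsometry_embX, hA.complIsometry_embX] at h
  have hc : Commute (plusInv A 1 ^ k) (mulPlusInv A 1 ^ k) :=
    (hA.commute_mulPlusInv one_pos one_pos).pow_pow k k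
  have h1 : ∀ y, (mulPlusInv A 1 ^ k) ((plusInv A 1 ^ k) y)
      = (plusInv A 1 ^ k) ((mulPlusInv A 1 ^ k) y) := fun y => (DFunLike.congr_fun hc.eq y).symm
  have h2 : (plusInv A 1 ^ k * plusInv A 1 ^ k) (complIsometry (opPow A k).toFun b)
      = (plusInv A 1 ^ k) ((plusInv A 1 ^ k) (complIsometry (opPow A k).toFun b)) := rfl
  rw [h1, h1, h2, ← map_add] at h
  have h3 := injective_pow (hA.plusInv_injective one_pos) k h
  have hT : Commute (plusInv A 1 ^ k) (idPlusPlusInv A l ^ k) :=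
    (hA.commute_idPlusPlusInv one_pos hl).pow_pow k k
  have hT' : Commute (mulPlusInv A 1 ^ k) (idPlusPlusInv A l ^ k) :=
    Commute.pow_pow ((Commute.one_left _).sub_left
      ((hA.commute_idPlusPlusInv one_pos hl).smul_left _)) k k
  -- After cancelling `R_1^k` the decomposition is known at the base point `1`; applying `T_l^k`
  -- moves it to `l`.
  rw [← hA.mulPlusInv_one_pow_mul hl, ← hA.plusInv_one_pow_mul hl, hT.eq, hT'.eq]
  have h4 := congrArg (idPlusPlusInv A l ^ k) h3
  rw [map_add] at h4
  exact h4.symm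

/-- Read in `X`, the resolvent power is `R_l^k = R_1^k T_l^k`, while `X` sits in `X_{-k}` through
the injective `R_1^k`. Hence `(l + A_{-k})⁻ᵏ w` always lies in `X`, and its `X`-norm is that of
`T_l^k` applied to the image of `w`. -/
theorem NegRegular.plusInv_extrapolated_pow_eq_iff (hA : NegRegular A) (k : ℕ) {l : ℝ}
    (hl : 0 < l) (x : X) (w : XNeg A k) :
    toXNeg A k x = (plusInv (extrapolated A k) l ^ k) w ↔
      x = (idPlusPlusInv A l ^ k) (complIsometry (idPlusInvPow A k) w) := by
  rw [← (complIsometry (idPlusInvPow A k)).injective.eq_iff,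
    hA.complIsometry_plusInv_extrapolated_pow k k hl,
    ← hA.plusInv_one_pow_mul hl, mul_apply_eq_comp]
  have : complIsometry (idPlusInvPow A k) (toXNeg A k x) = (plusInv A 1 ^ k) x :=
    complIsometry_toCompl _ x
  rw [this, (injective_pow (hA.plusInv_injective one_pos) k).eq_iff]

variable (hA : NegRegular A) {M : ℝ} (hM : ∀ l : ℝ, 0 < l → ‖(l : ℂ) • plusInv A l‖ ≤ M)
include hA hM

omit [CompleteSpace X] hA in
theorem exists_norm_pow_le (k : ℕ) :
    ∃ c : ℝ, 0 < c ∧ ∀ l : ℝ, 0 < l →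
      ‖mulPlusInv A l ^ k‖ ≤ c ∧ ‖plusInv A l ^ k‖ ≤ (l ^ k)⁻¹ * c := by
  obtain ⟨c₁, hc₁, h₁⟩ := exists_norm_aeval_le (𝔸 := X →L[ℂ] X) ((1 - Polynomial.X) ^ k) M
  obtain ⟨c₂, hc₂, h₂⟩ := exists_norm_aeval_le (𝔸 := X →L[ℂ] X) (Polynomial.X ^ k) M
  refine ⟨c₁ + c₂ + 1, by positivity, fun l hl => ?_⟩
  have hd : ‖mulPlusInv A l ^ k‖ ≤ c₁ := by
    have := h₁ (scaledPlusInv A l) (hM l hl)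
    rwa [map_pow, map_sub, map_one, Polynomial.aeval_X, ← mulPlusInv_eq] at this
  have hr : ‖plusInv A l ^ k‖ ≤ (l ^ k)⁻¹ * c₂ := by
    have := h₂ (scaledPlusInv A l) (hM l hl)
    rw [map_pow, Polynomial.aeval_X, scaledPlusInv_pow, norm_smul, Complex.norm_real,
      Real.norm_of_nonneg (by positivity)] at this
    rw [inv_mul_eq_div, le_div_iff₀ (by positivity)]
    linarith
  have h0 : 0 < (l ^ k)⁻¹ := by positivity
  exact ⟨by linarith, hr.trans (by gcongr; linarith)⟩

/-- For any decomposition `w = a + b`, the resolvent power turns the two pieces into `D_l^k (A⁻ᵏ a)`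
and `R_l^k b`, whose norms are at most `c ‖a‖` and `c l⁻ᵏ ‖b‖`. -/
theorem NegRegular.enorm_le_kFunctional_neg (hinj : Function.Injective A.toFun) (k : ℕ) :
    ∃ c : ℝ, 0 < c ∧ ∀ (l : ℝ), 0 < l → ∀ w : XNeg A k,
      ‖(idPlusPlusInv A l ^ k) (complIsometry (idPlusInvPow A k) w)‖ₑ
        ≤ ENNReal.ofReal c
          * kFunctional (embXDotNeg A k) (embX A k) (l ^ k)⁻¹ (embXNeg A k w) := by
  obtain ⟨c, hc, hcl⟩ := exists_norm_pow_le hM k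
  refine ⟨c, hc, fun l hl w => ?_⟩
  obtain ⟨hd, hr⟩ := hcl l hl
  refine enorm_le_mul_kFunctional (by positivity) (by positivity) fun a b hab => ?_
  rw [hA.embXDotNeg_add_embX_iff hinj] at hab
  have hT : Commute (plusInv A 1 ^ k) (idPlusPlusInv A l ^ k) :=
    (hA.commute_idPlusPlusInv one_pos hl).pow_pow k k
  have hT' : Commute (mulPlusInv A 1 ^ k) (idPlusPlusInv A l ^ k) :=
    Commute.pow_pow ((Commute.one_left _).sub_left
      ((hA.commute_idPlusPlusInv one_pos hl).smul_left _)) k k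
  have e : (idPlusPlusInv A l ^ k) (complIsometry (idPlusInvPow A k) w)
      = (mulPlusInv A l ^ k) (complIsometry (invPow A k).toFun a) + (plusInv A l ^ k) b := by
    rw [← hab, map_add, ← hA.mulPlusInv_one_pow_mul hl, ← hA.plusInv_one_pow_mul hl, hT.eq, hT'.eq]
    rfl
  rw [e]
  refine (norm_add_le _ _).trans ((add_le_add ((mulPlusInv A l ^ k).le_of_opNorm_le hd _)
    ((plusInv A l ^ k).le_of_opNorm_le hr _)).trans ?_)
  rw [LinearIsometry.norm_map]
  exact le_of_eq (by ring)

/-- An explicit near-optimal decomposition: with `x = (l + A_{-k})⁻ᵏ w`, take `A^k p(s) x` in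
`Ẋ_{-k}` and `l^k q(s) x` in `X`, where `(1 - s)^k p(s) + s^k q(s) = 1`. -/
theorem NegRegular.kFunctional_neg_le (hinj : Function.Injective A.toFun) {k : ℕ} (hk : 1 ≤ k) :
    ∃ c : ℝ, 0 ≤ c ∧ ∀ (l : ℝ), 0 < l → ∀ w : XNeg A k,
      kFunctional (embXDotNeg A k) (embX A k) (l ^ k)⁻¹ (embXNeg A k w)
        ≤ ENNReal.ofReal
          (c * ‖(idPlusPlusInv A l ^ k) (complIsometry (idPlusInvPow A k) w)‖) := by
  obtain ⟨Q, p, q, _, hq, hp, -⟩ := exists_beta_polynomial hk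
  obtain ⟨c₁, hc₁, h₁⟩ := exists_norm_aeval_le (𝔸 := X →L[ℂ] X) p M
  obtain ⟨c₂, hc₂, h₂⟩ := exists_norm_aeval_le (𝔸 := X →L[ℂ] X) q M
  refine ⟨c₁ + c₂, by positivity, fun l hl w => ?_⟩
  set z := complIsometry (idPlusInvPow A k) w with hz
  set s := scaledPlusInv A l with hs
  have hz' : z ∈ closure (Set.range (idPlusInvPow A k)) := by
    rw [← range_complIsometry]
    exact ⟨w, rfl⟩
  have hR := hA.commute one_pos hl
  have hTR : Commute (idPlusPlusInv A l) (plusInv A l) := (hA.commute_idPlusPlusInv hl hl).symm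
  -- Commuting operators keep the vector in the closure of the range of `(1 + A)⁻ᵏ`, and that range
  -- lies in the range of `A⁻ᵏ`; so the vector represents an element of `Ẋ_{-k}`.
  have hmem : Polynomial.aeval s p ((idPlusPlusInv A l ^ k) z)
      ∈ Set.range (complIsometry (invPow A k).toFun) := by
    rw [range_complIsometry]
    refine closure_mono ?_ (range_idPlusInvPow_mapsTo k
      (L := Polynomial.aeval s p * idPlusPlusInv A l ^ k)
      (((commute_aeval p hR).mul_right ((hA.commute_idPlusPlusInv one_pos hl).pow_right k)).symm) hz')
    rintro _ ⟨x, rfl⟩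
    exact hA.plusInv_pow_mem_range_invPow hinj one_pos k x
  obtain ⟨a, ha⟩ := hmem
  set b := ((l ^ k : ℝ) : ℂ) • Polynomial.aeval s q ((idPlusPlusInv A l ^ k) z) with hb
  have hD : Commute (mulPlusInv A 1) (plusInv A l) :=
    (Commute.one_left _).sub_left (hR.smul_left _)
  -- Absorbing `T_l^k` turns `D_1^k` and `R_1^k` into `(1 - s)^k` and `l⁻ᵏ s^k`; what remains is `(1
  -- - Q) + Q = 1` evaluated at `s`.
  have hid : mulPlusInv A 1 ^ k * (Polynomial.aeval s p * idPlusPlusInv A l ^ k)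
      + ((l ^ k : ℝ) : ℂ) • (plusInv A 1 ^ k * (Polynomial.aeval s q * idPlusPlusInv A l ^ k))
      = 1 := by
    have e1 := (commute_aeval p (hTR.pow_left k)).eq
    have e2 := (commute_aeval q (hTR.pow_left k)).eq
    rw [← e1, ← e2, ← mul_assoc, ← mul_assoc, hA.mulPlusInv_one_pow_mul hl,
      hA.plusInv_one_pow_mul hl, ← smul_mul_assoc, ← scaledPlusInv_pow, mulPlusInv_eq, ← hs]
    have h := congrArg (Polynomial.aeval s) (sub_add_cancel 1 Q)
    rw [map_add, hp] at h
    rw [hq] at h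
    simpa using h
  refine kFunctional_le (by positivity) a b ?_ ?_
  · rw [hA.embXDotNeg_add_embX_iff hinj, ha, hb, map_smul]
    exact DFunLike.congr_fun hid z
  · have n1 : ‖a‖ ≤ c₁ * ‖(idPlusPlusInv A l ^ k) z‖ := by
      rw [← (complIsometry (invPow A k).toFun).norm_map, ha]
      exact ContinuousLinearMap.le_of_opNorm_le _ (h₁ s (hM l hl)) _
    have n2 : (l ^ k)⁻¹ * ‖b‖ ≤ c₂ * ‖(idPlusPlusInv A l ^ k) z‖ := by
      rw [hb, norm_smul, Complex.norm_real, Real.norm_of_nonneg (by positivity),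
        inv_mul_cancel_left₀ (by positivity)]
      exact ContinuousLinearMap.le_of_opNorm_le _ (h₂ s (hM l hl)) _
    linarith

end Control

theorem inv_pow_rpow {l : ℝ} (hl : 0 < l) (k : ℕ) (r : ℝ) :
    ((l ^ k)⁻¹) ^ (-r) = l ^ ((k : ℝ) * r) := by
  rw [Real.inv_rpow (by positivity), Real.rpow_neg (by positivity), inv_inv, ← Real.rpow_natCast,
    ← Real.rpow_mul hl.le]

/-- The fundamental theorem of calculus on compact intervals, followed by limits at both ends. Since
the bound is an extended nonnegative integral, integrability of `f'` on the half-line is not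
required. -/
theorem enorm_le_lintegral_of_hasDerivAt {Y : Type*} [NormedAddCommGroup Y] [NormedSpace ℝ Y]
    [CompleteSpace Y] {f f' : ℝ → Y} {y : Y} (hd : ∀ t, 0 < t → HasDerivAt f (f' t) t)
    (hc : ContinuousOn f' (Set.Ioi 0)) (h₀ : Filter.Tendsto f (nhdsWithin 0 (Set.Ioi 0)) (nhds y))
    (h₁ : Filter.Tendsto f Filter.atTop (nhds 0)) :
    ‖y‖ₑ ≤ ∫⁻ t in Set.Ioi (0 : ℝ), ‖f' t‖ₑ := by
  have key : ∀ a b, 0 < a → a ≤ b → ‖f b - f a‖ₑ ≤ ∫⁻ t in Set.Ioi (0 : ℝ), ‖f' t‖ₑ := by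
    intro a b ha hab
    have hsub : Set.uIcc a b ⊆ Set.Ioi 0 := by
      rw [Set.uIcc_of_le hab]
      exact fun t ht => ha.trans_le ht.1
    rw [← intervalIntegral.integral_eq_sub_of_hasDerivAt (fun t ht => hd t (hsub ht))
      ((hc.mono hsub).intervalIntegrable), intervalIntegral.integral_of_le hab]
    exact (enorm_integral_le_lintegral_enorm _).trans
      (lintegral_mono_set fun t ht => ha.trans ht.1)
  have key' : ∀ a, 0 < a → ‖f a‖ₑ ≤ ∫⁻ t in Set.Ioi (0 : ℝ), ‖f' t‖ₑ := by
    intro a ha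
    have hlim : Filter.Tendsto (fun b => ‖f b - f a‖ₑ) Filter.atTop (nhds ‖0 - f a‖ₑ) :=
      (h₁.sub_const _).enorm
    rw [zero_sub, enorm_neg] at hlim
    exact le_of_tendsto hlim ((Filter.eventually_ge_atTop a).mono fun b hb => key a b ha hb)
  exact le_of_tendsto h₀.enorm (Filter.eventually_of_mem self_mem_nhdsWithin key')

/-! ### The two characterizations -/

section Characterizations

variable {X U Y : Type*} [NormedAddCommGroup X] [NormedSpace ℂ X] [CompleteSpace X]
  [NormedAddCommGroup U] [NormedSpace ℂ U] [NormedAddCommGroup Y] [NormedSpace ℂ Y]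
  {A : X →ₗ.[ℂ] X}

/-- The norm of `(l + A_{-k})⁻ᵏ B u` is equivalent to `K(l⁻ᵏ, B u)` uniformly in `l`, and `l ↦ l⁻ᵏ`
maps the positive half-line onto itself, so the two suprema are comparable. -/
theorem IsSectorial.control_iff (hA : IsSectorial A) (hinj : Function.Injective A.toFun) {k : ℕ}
    (hk : 1 ≤ k) (θ : ℝ) (B : U →L[ℂ] XNeg A k) :
    (∃ M : ℝ≥0, ∀ l : ℝ, 0 < l → ∀ u : U, ∃ x : X,
        toXNeg A k x = (plusInv (extrapolated A k) l ^ k) (B u) ∧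
          l ^ ((k : ℝ) * θ) * ‖x‖ ≤ M * ‖u‖) ↔
      ∃ M : ℝ≥0, ∀ u : U,
        interpNorm (embXDotNeg A k) (embX A k) θ ∞ (embXNeg A k (B u)) ≤ M * ‖u‖ₑ := by
  have hR := hA.negRegular
  obtain ⟨M₀, -, hM⟩ := hA.exists_bound
  simp only [interpNorm_top, iSup_le_iff]
  constructor
  · rintro ⟨M, h⟩
    obtain ⟨c, hc, hK⟩ := hR.kFunctional_neg_le hM hinj hk
    refine ⟨(c * M).toNNReal, fun u t ht => ?_⟩
    have hl : 0 < t ^ (-(1 / (k : ℝ))) := Real.rpow_pos_of_pos ht _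
    have hlk := rpow_neg_one_div_pow hk ht
    set l := t ^ (-(1 / (k : ℝ)))
    have h1 := hK l hl (B u)
    obtain ⟨x, hx, h2⟩ := h l hl u
    rw [← (hR.plusInv_extrapolated_pow_eq_iff k hl x (B u)).1 hx] at h1
    rw [← inv_pow_rpow hl, hlk, inv_inv] at h2
    rw [hlk, inv_inv] at h1
    refine (mul_le_mul_right h1 _).trans ?_
    rw [← ENNReal.ofReal_mul (by positivity), ← ofReal_norm]
    change _ ≤ ENNReal.ofReal (c * M) * _
    rw [← ENNReal.ofReal_mul (by positivity)]
    refine ENNReal.ofReal_le_ofReal ?_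
    calc t ^ (-θ) * (c * ‖x‖) = c * (t ^ (-θ) * ‖x‖) := by ring
      _ ≤ c * (M * ‖u‖) := by gcongr
      _ = c * M * ‖u‖ := by ring
  · rintro ⟨M, h⟩
    obtain ⟨c, hc, hK⟩ := hR.enorm_le_kFunctional_neg hM hinj k
    refine ⟨(c * M).toNNReal, fun l hl u => ?_⟩
    refine ⟨_, (hR.plusInv_extrapolated_pow_eq_iff k hl _ _).2 rfl, ?_⟩
    have h1 := hK l hl (B u)
    have h2 := h u (l ^ k)⁻¹ (by positivity)
    rw [inv_pow_rpow hl] at h2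
    set x := (idPlusPlusInv A l ^ k) (complIsometry (idPlusInvPow A k) (B u))
    have h3 : ENNReal.ofReal (l ^ ((k : ℝ) * θ)) * ‖x‖ₑ ≤ ENNReal.ofReal c * (M * ‖u‖ₑ) := by
      refine (mul_le_mul_right h1 _).trans ?_
      rw [mul_left_comm]
      exact mul_le_mul_right h2 _
    rw [← ofReal_norm, ← ofReal_norm, ← ENNReal.ofReal_coe_nnreal,
      ← ENNReal.ofReal_mul (by positivity), ← ENNReal.ofReal_mul (by positivity),
      ← ENNReal.ofReal_mul (by positivity), ENNReal.ofReal_le_ofReal_iff (by positivity),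
      ← mul_assoc] at h3
    rwa [Real.coe_toNNReal _ (by positivity)]

omit [CompleteSpace X] in
/-- `C` factors through the bounded operator `C (1 + A)⁻ᵏ`. -/
theorem NegRegular.exists_observation_comp (hR : NegRegular A) (k : ℕ) (C : XPos A k →L[ℂ] Y) :
    ∃ C' : X →L[ℂ] Y,
      (∀ l : ℝ, 0 < l → ∀ x, C (toRenorm (idPlusPow A k) (plusInvPow A l k x))
        = C' ((idPlusPlusInv A l ^ k) x)) ∧
      ∀ d : (opPow A k).domain, C (toRenorm (idPlusPow A k) d) = C' (idPlusPow A k d) := by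
  have hbd : ∀ y : X, ‖(C.toLinearMap ∘ₗ (toRenorm (idPlusPow A k)).toLinearMap ∘ₗ
      plusInvPow A 1 k) y‖ ≤ ‖C‖ * ‖y‖ := by
    intro y
    refine (C.le_opNorm _).trans_eq ?_
    have h : ‖toRenorm (idPlusPow A k) (plusInvPow A 1 k y)‖ = ‖y‖ := by
      rw [norm_toRenorm, hR.idPlusPow_plusInvPow one_pos]
      simp [idPlusPlusInv]
    exact congrArg _ h
  refine ⟨LinearMap.mkContinuous _ _ hbd, fun l hl x => ?_, fun d => ?_⟩
  · have e : plusInvPow A l k x = plusInvPow A 1 k ((idPlusPlusInv A l ^ k) x) :=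
      Subtype.ext (DFunLike.congr_fun (hR.plusInv_one_pow_mul hl k) x).symm
    rw [e]
    rfl
  · have e : d = plusInvPow A 1 k (idPlusPow A k d) :=
      Subtype.ext (hR.plusInv_pow_idPlusPow k d).symm
    nth_rewrite 1 [e]
    rfl

omit [CompleteSpace X] in
-- The two trivial decompositions suffice: putting everything in `X` costs `c l⁻ᵏ ‖x‖`, putting
-- everything in `Ẋ_k` costs `t c ‖x‖`.
theorem IsSectorial.interpNorm_plusInvPow_le (hA : IsSectorial A) (k : ℕ) {θ : ℝ} (hθ₀ : 0 < θ)
    (hθ₁ : θ < 1) :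
    ∃ c : ℝ, 0 ≤ c ∧ ∀ l : ℝ, 0 < l → ∀ x : X,
      interpNorm (embX A k) (embXDotPos A k) θ 1
        (embXPos A k (toRenorm (idPlusPow A k) (plusInvPow A l k x)))
          ≤ ENNReal.ofReal (c * ‖x‖ * l ^ (-((k : ℝ) * (1 - θ)))) := by
  have hR := hA.negRegular
  obtain ⟨M₀, -, hM⟩ := hA.exists_bound
  obtain ⟨c, hc, hcl⟩ := exists_norm_pow_le hM k
  have h3 : 0 < 1 - θ := by linarith
  refine ⟨c * (1 / (1 - θ) + 1 / θ), by positivity, fun l hl x => ?_⟩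
  obtain ⟨hd, hr⟩ := hcl l hl
  have hl' : 0 < (l ^ k)⁻¹ := by positivity
  refine (interpNorm_one_le (r := c * ‖x‖) hθ₀ hθ₁ hl' (by positivity) fun t ht => ?_).trans_eq ?_
  · rcases le_total (l ^ k)⁻¹ t with h | h
    · rw [min_eq_left h]
      refine kFunctional_le ht.le ((plusInv A l ^ k) x) 0 ?_ ?_
      · have h0 : embXDotPos A k 0 = 0 := by
          have := hR.embXDotPos_toCompl k 0
          rw [map_zero] at this
          rw [this]
          exact map_zero (toCompl (regularizer A k))
        rw [h0, add_zero]
        rfl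
      · rw [norm_zero, mul_zero, add_zero]
        exact ((plusInv A l ^ k).le_of_opNorm_le hr x).trans_eq (by ring)
    · rw [min_eq_right h]
      refine kFunctional_le ht.le 0 (toCompl _ (plusInvPow A l k x)) ?_ ?_
      · rw [hR.embXDotPos_toCompl, show embX A k 0 = 0 from map_zero (toCompl (regularizer A k)),
          zero_add]
        rfl
      · rw [norm_zero, zero_add, norm_toCompl, hR.opPow_plusInvPow hl, mul_comm]
        gcongr
        exact (mulPlusInv A l ^ k).le_of_opNorm_le hd x
  · have e := inv_pow_rpow hl k (-(1 - θ))
    rw [neg_neg, mul_neg] at e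
    rw [e]
    congr 1
    ring

/-- If `x = a + b` with `a` in `X` and `b` in `Ẋ_k`, then `D_l^k x = D_l^k a + R_l^k (A^k b)`. -/
theorem NegRegular.enorm_mulPlusInv_pow_le (hR : NegRegular A) {M : ℝ}
    (hM : ∀ l : ℝ, 0 < l → ‖(l : ℂ) • plusInv A l‖ ≤ M) (k : ℕ) :
    ∃ c : ℝ, 0 < c ∧ ∀ l : ℝ, 0 < l → ∀ x : X,
      ‖(mulPlusInv A l ^ k) x‖ₑ ≤ ENNReal.ofReal c
        * kFunctional (embX A k) (embXDotPos A k) (l ^ k)⁻¹ (embX A k x) := by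
  obtain ⟨c, hc, hcl⟩ := exists_norm_pow_le hM k
  refine ⟨c, hc, fun l hl x => enorm_le_mul_kFunctional hc (by positivity) fun a b hab => ?_⟩
  obtain ⟨hd, hr⟩ := hcl l hl
  rw [hR.embX_add_embXDotPos hab hl]
  refine (norm_add_le _ _).trans ((add_le_add ((mulPlusInv A l ^ k).le_of_opNorm_le hd _)
    ((plusInv A l ^ k).le_of_opNorm_le hr _)).trans ?_)
  rw [LinearIsometry.norm_map]
  exact le_of_eq (by ring)

variable [CompleteSpace Y]

open Polynomial in
-- Here `C` plays the role of the bounded operator `C (1 + A)⁻ᵏ` and `x = (1 + A)⁻ᵏ y`. The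
-- reproducing formula writes `C y` as the integral of a multiple of `t⁻¹ C s^k D_l^k y`, with `l =
-- t^{-1/k}`.
theorem IsSectorial.enorm_le_interpNorm (hA : IsSectorial A) {k : ℕ} (hk : 1 ≤ k) {θ : ℝ}
    (hθ₀ : 0 < θ) (hθ₁ : θ < 1) (C : X →L[ℂ] Y) {M : ℝ} (hM₀ : 0 ≤ M)
    (hC : ∀ l : ℝ, 0 < l → ∀ x : X,
      l ^ ((k : ℝ) * (1 - θ)) * ‖C ((idPlusPlusInv A l ^ k) x)‖ ≤ M * ‖x‖) :
    ∃ M' : ℝ≥0, ∀ y : X,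
      ‖C y‖ₑ ≤ M' * interpNorm (embX A k) (embXDotPos A k) θ 1 (embX A k ((plusInv A 1 ^ k) y)) := by
  have hR := hA.negRegular
  obtain ⟨M₀, -, hM⟩ := hA.exists_bound
  obtain ⟨c, hc, hK⟩ := hR.enorm_mulPlusInv_pow_le hM k
  obtain ⟨Q, p, q, c₀, hq, hp, hQ⟩ := exists_beta_polynomial hk
  obtain ⟨c₁, hc₁, h₁⟩ := exists_norm_aeval_le (𝔸 := X →L[ℂ] X) p M₀
  obtain ⟨c₂, hc₂, h₂⟩ := exists_norm_aeval_le (𝔸 := X →L[ℂ] X) q M₀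
  set α : ℝ := -(1 / (k : ℝ))
  have hpos : ∀ t : ℝ, 0 < t → 0 < t ^ α := fun t ht => Real.rpow_pos_of_pos ht _
  have hpow : ∀ t : ℝ, 0 < t → (t ^ α) ^ k = t⁻¹ := fun t ht => rpow_neg_one_div_pow hk ht
  have hC' : ∀ t : ℝ, 0 < t → ∀ x, ‖C ((idPlusPlusInv A (t ^ α) ^ k) x)‖
      ≤ t ^ (1 - θ) * (M * ‖x‖) := by
    intro t ht x
    have h := hC _ (hpos t ht) x
    rw [← inv_pow_rpow (hpos t ht), hpow t ht, inv_inv, Real.rpow_neg ht.le,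
      inv_mul_le_iff₀ (by positivity)] at h
    exact h
  have hT : ∀ l : ℝ, 0 < l → plusInv A l ^ k = idPlusPlusInv A l ^ k * plusInv A 1 ^ k := by
    intro l hl
    rw [← hR.plusInv_one_pow_mul hl,
      ((hR.commute_idPlusPlusInv one_pos hl).pow_pow k k).eq]
  have hTD : ∀ l : ℝ, 0 < l → mulPlusInv A l ^ k = idPlusPlusInv A l ^ k * mulPlusInv A 1 ^ k := by
    intro l hl
    rw [← hR.mulPlusInv_one_pow_mul hl]
    exact (Commute.pow_pow ((Commute.one_left _).sub_left
      ((hR.commute_idPlusPlusInv one_pos hl).smul_left _)) k k).eq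
  have hS : ∀ t : ℝ, 0 < t → ∀ L : X →L[ℂ] X, Commute (plusInv A 1) L → ∀ y,
      (scaledPlusInv A (t ^ α) ^ k * L) y = ((t⁻¹ : ℝ) : ℂ) •
        (idPlusPlusInv A (t ^ α) ^ k) (L ((plusInv A 1 ^ k) y)) := by
    intro t ht L hL y
    rw [scaledPlusInv_pow, hpow t ht, hT _ (hpos t ht), smul_mul_assoc, mul_assoc,
      (hL.pow_left k).eq]
    rfl
  -- The factor `l^k = t⁻¹` in `s^k` meets the bound `t^{1-θ}` of the hypothesis, leaving exactly
  -- the interpolation weight `t^{-θ}`.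
  have hSn : ∀ t : ℝ, 0 < t → ∀ L : X →L[ℂ] X, Commute (plusInv A 1) L → ∀ y,
      ‖C ((scaledPlusInv A (t ^ α) ^ k * L) y)‖
        ≤ t ^ (-θ) * (M * ‖L ((plusInv A 1 ^ k) y)‖) := by
    intro t ht L hL y
    rw [hS t ht L hL, map_smul, norm_smul, Complex.norm_real, Real.norm_of_nonneg (by positivity)]
    refine (mul_le_mul_of_nonneg_left (hC' t ht _) (by positivity)).trans_eq ?_
    rw [← mul_assoc, sub_eq_add_neg, Real.rpow_add ht, Real.rpow_one, inv_mul_cancel_left₀ ht.ne']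
  -- `α` is the exponent in `l = t^α`, `c₀` the normalization of `Q'`, and `M` the bound in the
  -- hypothesis.
  obtain ⟨N, hN⟩ : ∃ N : ℝ, N = ‖α‖ * ‖c₀‖ * M := ⟨_, rfl⟩
  have hN0 : 0 ≤ N := by rw [hN]; positivity
  refine ⟨(N * c).toNNReal, fun y => ?_⟩
  set x := (plusInv A 1 ^ k) y with hx
  set f : ℝ → Y := fun t => C (aeval (scaledPlusInv A (t ^ α)) Q y) with hf
  set f' : ℝ → Y := fun t => C (((α * t⁻¹) • c₀ •
    (scaledPlusInv A (t ^ α) ^ k * mulPlusInv A (t ^ α) ^ k)) y) with hf'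
  have hd : ∀ t, 0 < t → HasDerivAt f (f' t) t := by
    intro t ht
    have h := hR.hasDerivAt_aeval_scaledPlusInv hM hQ (a := α) ht
    rw [Nat.sub_add_cancel hk] at h
    have h1 := ((C.restrictScalars ℝ).comp
      ((ContinuousLinearMap.apply ℂ X y).restrictScalars ℝ)).hasFDerivAt.comp_hasDerivAt t h
    exact h1
  have hcont : ContinuousOn f' (Set.Ioi 0) := by
    intro t ht
    have ht : 0 < t := ht
    have h1 : ContinuousAt (fun t : ℝ => scaledPlusInv A (t ^ α)) t :=
      ((hR.hasDerivAt_scaledPlusInv hM (hpos t ht)).continuousAt).comp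
        (f := fun t : ℝ => t ^ α) (Real.continuousAt_rpow_const _ _ (Or.inl ht.ne'))
    have h2 : ContinuousAt (fun t : ℝ => mulPlusInv A (t ^ α)) t := continuousAt_const.sub h1
    have h3 : ContinuousAt (fun t : ℝ => (α * t⁻¹) • c₀ •
        (scaledPlusInv A (t ^ α) ^ k * mulPlusInv A (t ^ α) ^ k)) t :=
      (continuousAt_const.mul (continuousAt_inv₀ ht.ne')).smul
        (((h1.pow k).mul (h2.pow k)).const_smul c₀)
    exact (C.continuous.continuousAt.comp (h3.clm_apply continuousAt_const)).continuousWithinAt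
  -- `Q` contains the factor `X^k`, so `hSn` gives decay like `t^{-θ}`.
  have hlim₁ : Filter.Tendsto f Filter.atTop (nhds 0) := by
    have h := (tendsto_rpow_neg_atTop hθ₀).mul_const (M * (c₂ * ‖x‖))
    rw [zero_mul] at h
    refine squeeze_zero_norm' ?_ h
    filter_upwards [Filter.eventually_gt_atTop 0] with t ht
    have e : f t = C ((scaledPlusInv A (t ^ α) ^ k * aeval (scaledPlusInv A (t ^ α)) q) y) := by
      simp only [hf, hq, map_mul, map_pow, aeval_X]
    rw [e]
    refine (hSn t ht _ (commute_aeval q (hR.commute one_pos (hpos t ht))) y).trans ?_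
    gcongr
    exact ContinuousLinearMap.le_of_opNorm_le _ (h₂ _ (hM _ (hpos t ht))) _
  -- Without a dense domain `Q(s) y` need not tend to `y` in `X`. After applying `C` it does
  -- converge: `1 - Q` contains `(1 - X)^k`, so the error is `C T_l^k D_1^k p(s) y`, of size
  -- `t^{1-θ}` by hypothesis.
  have hlim₀ : Filter.Tendsto f (nhdsWithin 0 (Set.Ioi 0)) (nhds (C y)) := by
    have h : Filter.Tendsto (fun t : ℝ => t ^ (1 - θ) * (M * (‖mulPlusInv A 1 ^ k‖ * (c₁ * ‖y‖))))
        (nhdsWithin 0 (Set.Ioi 0)) (nhds 0) := by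
      have h1 := (Real.continuousAt_rpow_const 0 (1 - θ) (Or.inr (by linarith))).tendsto
      rw [Real.zero_rpow (by linarith)] at h1
      have h2 := (h1.mul_const (M * (‖mulPlusInv A 1 ^ k‖ * (c₁ * ‖y‖))))
      rw [zero_mul] at h2
      exact h2.mono_left nhdsWithin_le_nhds
    rw [tendsto_iff_norm_sub_tendsto_zero]
    refine squeeze_zero' (Filter.Eventually.of_forall fun _ => norm_nonneg _) ?_ h
    filter_upwards [self_mem_nhdsWithin] with t ht
    have ht : 0 < t := ht
    have e : C y - f t = C ((idPlusPlusInv A (t ^ α) ^ k)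
        ((mulPlusInv A 1 ^ k) (aeval (scaledPlusInv A (t ^ α)) p y))) := by
      have h1 := congrArg (aeval (scaledPlusInv A (t ^ α))) hp
      rw [map_sub, map_one, map_mul, map_pow, map_sub, map_one, aeval_X, ← mulPlusInv_eq,
        hTD _ (hpos t ht)] at h1
      rw [hf, ← map_sub]
      exact congrArg C (DFunLike.congr_fun h1 y)
    rw [norm_sub_rev, e]
    refine (hC' t ht _).trans ?_
    gcongr
    refine ((mulPlusInv A 1 ^ k).le_opNorm _).trans ?_
    gcongr
    exact ContinuousLinearMap.le_of_opNorm_le _ (h₁ _ (hM _ (hpos t ht))) _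
  refine (enorm_le_lintegral_of_hasDerivAt hd hcont hlim₀ hlim₁).trans ?_
  rw [interpNorm_one]
  change _ ≤ ENNReal.ofReal (N * c) * _
  rw [← lintegral_const_mul' _ _ ENNReal.ofReal_ne_top]
  refine setLIntegral_mono' measurableSet_Ioi fun t ht => ?_
  have ht : 0 < t := ht
  have hKt := hK _ (hpos t ht) x
  rw [hpow t ht, inv_inv] at hKt
  have hcomm : Commute (plusInv A 1) (mulPlusInv A (t ^ α) ^ k) :=
    (hR.commute_mulPlusInv one_pos (hpos t ht)).pow_right k
  have hn : ‖f' t‖ ≤ N * (t ^ (-θ) * t⁻¹ * ‖(mulPlusInv A (t ^ α) ^ k) x‖) := by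
    have e : f' t = (α * t⁻¹) • c₀ •
        C ((scaledPlusInv A (t ^ α) ^ k * mulPlusInv A (t ^ α) ^ k) y) := by
      have h1 : ∀ v : X, C ((α * t⁻¹) • c₀ • v) = (α * t⁻¹) • c₀ • C v := by
        intro v
        rw [ContinuousLinearMap.map_smul_of_tower, map_smul]
      exact h1 _
    rw [e, norm_smul, norm_smul, norm_mul, Real.norm_of_nonneg (inv_nonneg.2 ht.le)]
    calc ‖α‖ * t⁻¹ * (‖c₀‖ * ‖C ((scaledPlusInv A (t ^ α) ^ k * mulPlusInv A (t ^ α) ^ k) y)‖)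
        ≤ ‖α‖ * t⁻¹ * (‖c₀‖ * (t ^ (-θ) * (M * ‖(mulPlusInv A (t ^ α) ^ k) x‖))) := by
          gcongr
          exact hSn t ht _ hcomm y
      _ = _ := by rw [hN]; ring
  calc ‖f' t‖ₑ ≤ ENNReal.ofReal (N * (t ^ (-θ) * t⁻¹ * ‖(mulPlusInv A (t ^ α) ^ k) x‖)) := by
        rw [← ofReal_norm]
        exact ENNReal.ofReal_le_ofReal hn
    _ = ENNReal.ofReal N * (ENNReal.ofReal (t ^ (-θ)) * ENNReal.ofReal t⁻¹ *
          ‖(mulPlusInv A (t ^ α) ^ k) x‖ₑ) := by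
        rw [ENNReal.ofReal_mul hN0, ENNReal.ofReal_mul (by positivity),
          ENNReal.ofReal_mul (by positivity), ofReal_norm]
    _ ≤ ENNReal.ofReal N * (ENNReal.ofReal (t ^ (-θ)) * ENNReal.ofReal t⁻¹ *
          (ENNReal.ofReal c * kFunctional (embX A k) (embXDotPos A k) t (embX A k x))) := by
        gcongr
    _ = _ := by
        rw [ENNReal.ofReal_mul hN0]
        ring

theorem IsSectorial.observation_iff (hA : IsSectorial A) {k : ℕ} (hk : 1 ≤ k) {θ : ℝ}
    (hθ₀ : 0 < θ) (hθ₁ : θ < 1) (C : XPos A k →L[ℂ] Y) :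
    (∃ M : ℝ≥0, ∀ l : ℝ, 0 < l → ∀ x : X,
        l ^ ((k : ℝ) * (1 - θ)) * ‖C (toRenorm (idPlusPow A k) (plusInvPow A l k x))‖
          ≤ M * ‖x‖) ↔
      ∃ M : ℝ≥0, ∀ x : XPos A k,
        ‖C x‖ₑ ≤ M * interpNorm (embX A k) (embXDotPos A k) θ 1 (embXPos A k x) := by
  have hR := hA.negRegular
  constructor
  · rintro ⟨M, h⟩
    obtain ⟨C', h1, h2⟩ := hR.exists_observation_comp k C
    obtain ⟨M', h3⟩ := hA.enorm_le_interpNorm hk hθ₀ hθ₁ C' M.2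
      fun l hl x => by rw [← h1 l hl]; exact h l hl x
    refine ⟨M', fun x => ?_⟩
    -- Every `x` in `X_k` is `(1 + A)⁻ᵏ y` with `y = (1 + A)ᵏ x`, so the estimate for the bounded
    -- operator covers all of `X_k`.
    have h4 := h3 (idPlusPow A k ((toRenorm (idPlusPow A k)).symm x))
    rw [← h2, hR.plusInv_pow_idPlusPow, LinearEquiv.apply_symm_apply] at h4
    exact h4
  · rintro ⟨M, h⟩
    obtain ⟨c, hc, h1⟩ := hA.interpNorm_plusInvPow_le k hθ₀ hθ₁
    refine ⟨M * c.toNNReal, fun l hl x => ?_⟩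
    have h2 := (h (toRenorm (idPlusPow A k) (plusInvPow A l k x))).trans
      (mul_le_mul_right (h1 l hl x) _)
    rw [← ofReal_norm, ← ENNReal.ofReal_coe_nnreal, ← ENNReal.ofReal_mul (by positivity),
      ENNReal.ofReal_le_ofReal_iff (by positivity), Real.rpow_neg hl.le] at h2
    rw [NNReal.coe_mul, Real.coe_toNNReal _ hc, mul_comm, ← le_div_iff₀ (by positivity)]
    exact h2.trans_eq (by ring)

end Characterizations

end SectorialInterpolation

end

theorem theorem1p7
    {X U Y : Type*}
    [NormedAddCommGroup X] [NormedSpace ℂ X] [CompleteSpace X]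
    [NormedAddCommGroup U] [NormedSpace ℂ U] [CompleteSpace U]
    [NormedAddCommGroup Y] [NormedSpace ℂ Y] [CompleteSpace Y]
    (A : X →ₗ.[ℂ] X) (hA : IsSectorial A) (hinj : Function.Injective A.toFun)
    (k : ℕ) (hk : 1 ≤ k) (θ : ℝ) (hθ₀ : 0 < θ) (hθ₁ : θ < 1)
    (C : XPos A k →L[ℂ] Y) (B : U →L[ℂ] XNeg A k) :
    -- the control operator `B`
    ((∃ M : ℝ≥0, ∀ l : ℝ, 0 < l → ∀ u : U, ∃ x : X,
        toXNeg A k x = (plusInv (extrapolated A k) l ^ k) (B u) ∧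
          l ^ ((k : ℝ) * θ) * ‖x‖ ≤ M * ‖u‖) ↔
      ∃ M : ℝ≥0, ∀ u : U,
        interpNorm (embXDotNeg A k) (embX A k) θ ∞ (embXNeg A k (B u)) ≤ M * ‖u‖ₑ) ∧
    -- the observation operator `C`
    ((∃ M : ℝ≥0, ∀ l : ℝ, 0 < l → ∀ x : X,
        l ^ ((k : ℝ) * (1 - θ)) * ‖C (toRenorm (idPlusPow A k) (plusInvPow A l k x))‖
          ≤ M * ‖x‖) ↔
      ∃ M : ℝ≥0, ∀ x : XPos A k,
        ‖C x‖ₑ ≤ M * interpNorm (embX A k) (embXDotPos A k) θ 1 (embXPos A k x)) := by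
  exact ⟨hA.control_iff hinj hk θ B, hA.observation_iff hk hθ₀ hθ₁ C⟩
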